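/- Let $p_0=(0,0)$, $p_1=(1,0)$, $p_2=(\tfrac12,\tfrac{\sqrt3}{2})$ and $f_i(x)=\tfrac12(x+p_i)$ for $x\in\mathbb{R}^2$, $i=0,1,2$. Let $K\subseteq\mathbb{R}^2$ be the Sierpiński gasket, i.e. the unique nonempty compact set with $K=f_0(K)\cup f_1(K)\cup f_2(K)$, equipped with the Euclidean metric $|x-y|$. Put $\alpha=\frac{\log 3}{\log 2}$ and $\beta^*=\frac{\log 5}{\log 2}$, and let $\nu=\mathcal{H}^\alpha|_K/\mathcal{H}^\alpha(K)$ be the normalized $\alpha$-dimensional Hausdorff measure on $K$. For $\beta\in\mathbb{R}$ let $$\mathcal{F}_K=\Big\{u\in L^2(K;\nu):\ \int_K\int_K\frac{(u(x)-u(y))^2}{|x-y|^{\alpha+\beta}}\,\nu(dx)\,\nu(dy)<+\infty\Big\},$$ $$\mathcal{E}_K(u,v)=\int_K\int_K\frac{(u(x)-u(y))(v(x)-v(y))}{|x-y|^{\alpha+\beta}}\,\nu(dx)\,\nu(dy),\qquad u,v\in\mathcal{F}_K.$$ If $\alpha<\beta<\beta^*$, then $(\mathcal{E}_K,\mathcal{F}_K)$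 is a regular Dirichlet form on $L^2(K;\nu)$. That is: $\nu$ is a Radon measure with full support in the compact metric space $K$; $\mathcal{F}_K$ is a dense linear subspace of $L^2(K;\nu)$ and $\mathcal{E}_K$ is a symmetric nonnegative definite bilinear form on it; $\mathcal{F}_K$ is complete for the norm $\big(\mathcal{E}_K(u,u)+\|u\|_{L^2(K;\nu)}^2\big)^{1/2}$; for every $u\in\mathcal{F}_K$, the function $\bar u=\min(\max(u,0),1)$ belongs to $\mathcal{F}_K$ and $\mathcal{E}_K(\bar u,\bar u)\le\mathcal{E}_K(u,u)$; and $C(K)\cap\mathcal{F}_K$ is dense in $\mathcal{F}_K$ for the above norm and uniformly dense in $C(K)$. -/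

import Mathlib

open MeasureTheory Filter Topology Set
open scoped ENNReal

/-! ### Dirichlet forms -/

/-- The squared `𝓔₁`-norm `𝓔(u,u) + ‖u‖²_{L²}` of an element of the domain `F` of a form `E`
on `L²(X; μ)`. -/
noncomputable def formNormSq {X : Type*} [MeasurableSpace X] {μ : Measure X}
    {F : Submodule ℝ (Lp ℝ 2 μ)} (E : F →ₗ[ℝ] F →ₗ[ℝ] ℝ) (u : F) : ℝ :=
  E u u + ‖(u : Lp ℝ 2 μ)‖ ^ 2

/-- `(E, F)` is a (symmetric) Dirichlet form on `L²(X; μ)`: a densely defined, symmetric,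
nonnegative definite bilinear form that is closed and Markovian. -/
structure IsDirichletForm {X : Type*} [MeasurableSpace X] (μ : Measure X)
    (F : Submodule ℝ (Lp ℝ 2 μ)) (E : F →ₗ[ℝ] F →ₗ[ℝ] ℝ) : Prop where
  dense_domain : Dense (F : Set (Lp ℝ 2 μ))
  symm : ∀ u v : F, E u v = E v u
  nonneg : ∀ u : F, 0 ≤ E u u
  /-- The domain is complete with respect to the `𝓔₁`-norm. -/
  closed : ∀ u : ℕ → F,
    (∀ ε : ℝ, 0 < ε → ∃ N : ℕ, ∀ m, N ≤ m → ∀ n, N ≤ n → formNormSq E (u m - u n) < ε) →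
    ∃ v : F, Tendsto (fun n => formNormSq E (u n - v)) atTop (𝓝 0)
  /-- The unit contraction `(0 ∨ u) ∧ 1` operates on `(E, F)`. -/
  markov : ∀ u : F, ∃ v : F,
    ((v : Lp ℝ 2 μ) : X → ℝ) =ᵐ[μ] (fun x => min (max ((u : Lp ℝ 2 μ) x) 0) 1) ∧
      E v v ≤ E u u

/-- `(E, F)` is a regular Dirichlet form on `L²(X; μ)`, where `X` is a locally compact separable
metric space and `μ` is a Radon measure of full support: it is a Dirichlet form such that
`C₀(X) ∩ F` is `𝓔₁`-dense in `F` and uniformly dense in `C₀(X)`, with `C₀(X)` the space of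
continuous functions of compact support. (A Borel measure on such a space is Radon
as soon as it is finite on compact sets.) -/
structure IsRegularDirichletForm {X : Type*} [MetricSpace X] [LocallyCompactSpace X]
    [TopologicalSpace.SeparableSpace X] [MeasurableSpace X] [BorelSpace X] (μ : Measure X)
    (F : Submodule ℝ (Lp ℝ 2 μ)) (E : F →ₗ[ℝ] F →ₗ[ℝ] ℝ) : Prop
    extends IsDirichletForm μ F E where
  finite_on_compacts : IsFiniteMeasureOnCompacts μ
  full_support : μ.IsOpenPosMeasure
  dense_in_domain : ∀ u : F, ∀ ε : ℝ, 0 < ε → ∃ v : F,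
    (∃ g : X → ℝ, Continuous g ∧ HasCompactSupport g ∧ ((v : Lp ℝ 2 μ) : X → ℝ) =ᵐ[μ] g) ∧
      formNormSq E (u - v) < ε
  dense_in_continuous : ∀ f : X → ℝ, Continuous f → HasCompactSupport f →
    ∀ ε : ℝ, 0 < ε → ∃ g : X → ℝ, Continuous g ∧ HasCompactSupport g ∧
      (∃ v : F, ((v : Lp ℝ 2 μ) : X → ℝ) =ᵐ[μ] g) ∧ ∀ x, |f x - g x| < ε

/-! ### The non-local form with kernel `d(x,y)^{-s}` on a metric measure space -/

section JumpForm

/-- `(u(x) - u(y)) (v(x) - v(y)) / d(x,y)^s` at `p = (x, y)`. -/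
noncomputable def jumpDensity {X : Type*} [MetricSpace X] (s : ℝ) (u v : X → ℝ) (p : X × X) : ℝ :=
  (u p.1 - u p.2) * (v p.1 - v p.2) / dist p.1 p.2 ^ s

/-- `∬ (u(x) - u(y))² / d(x,y)^s dμ(x) dμ(y)`, with values in `[0, ∞]`. -/
noncomputable def jumpEnergy {X : Type*} [MetricSpace X] [MeasurableSpace X] (μ : Measure X)
    (s : ℝ) (u : X → ℝ) : ℝ≥0∞ :=
  ∫⁻ p, ENNReal.ofReal ((u p.1 - u p.2) ^ 2 / dist p.1 p.2 ^ s) ∂(μ.prod μ)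

variable {X : Type*} [MetricSpace X]

lemma jumpDensity_self (s : ℝ) (u : X → ℝ) (p : X × X) :
    jumpDensity s u u p = (u p.1 - u p.2) ^ 2 / dist p.1 p.2 ^ s := by
  rw [jumpDensity, sq]

lemma jumpDensity_self_nonneg (s : ℝ) (u : X → ℝ) (p : X × X) : 0 ≤ jumpDensity s u u p := by
  rw [jumpDensity_self]; positivity

lemma jumpDensity_add_left (s : ℝ) (u v w : X → ℝ) (p : X × X) :
    jumpDensity s (u + v) w p = jumpDensity s u w p + jumpDensity s v w p := by
  simp only [jumpDensity, Pi.add_apply]; ring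

lemma jumpDensity_smul_left (s c : ℝ) (u w : X → ℝ) (p : X × X) :
    jumpDensity s (c • u) w p = c * jumpDensity s u w p := by
  simp only [jumpDensity, Pi.smul_apply, smul_eq_mul]; ring

lemma jumpDensity_comm (s : ℝ) (u w : X → ℝ) (p : X × X) :
    jumpDensity s u w p = jumpDensity s w u p := by
  simp only [jumpDensity, mul_comm]

lemma jumpDensity_abs_le (s : ℝ) (u v : X → ℝ) (p : X × X) :
    |jumpDensity s u v p| ≤ jumpDensity s u u p + jumpDensity s v v p := by
  have hd : 0 ≤ dist p.1 p.2 ^ s := by positivity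
  simp only [jumpDensity]
  rw [abs_div, abs_of_nonneg hd, ← add_div]
  refine div_le_div_of_nonneg_right ?_ hd
  rw [abs_le]
  constructor <;>
    nlinarith [sq_nonneg ((u p.1 - u p.2) + (v p.1 - v p.2)),
      sq_nonneg ((u p.1 - u p.2) - (v p.1 - v p.2)), sq_nonneg (u p.1 - u p.2),
      sq_nonneg (v p.1 - v p.2)]

variable [MeasurableSpace X] {μ : Measure X}

lemma jumpDensity_congr (s : ℝ) {u u' v v' : X → ℝ} (hu : u =ᵐ[μ] u') (hv : v =ᵐ[μ] v') :
    jumpDensity s u v =ᵐ[μ.prod μ] jumpDensity s u' v' := by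
  have q1 := Measure.quasiMeasurePreserving_fst (μ := μ) (ν := μ)
  have q2 := Measure.quasiMeasurePreserving_snd (μ := μ) (ν := μ)
  filter_upwards [q1.ae hu, q2.ae hu, q1.ae hv, q2.ae hv] with p h1 h2 h3 h4
  simp only [jumpDensity, h1, h2, h3, h4]

variable [SecondCountableTopology X] [BorelSpace X]

lemma jumpDensity_measurable (s : ℝ) (u v : Lp ℝ 2 μ) : Measurable (jumpDensity s u v) := by
  have hu : Measurable u := (Lp.stronglyMeasurable u).measurable
  have hv : Measurable v := (Lp.stronglyMeasurable v).measurable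
  have hd : Measurable fun p : X × X => dist p.1 p.2 := measurable_fst.dist measurable_snd
  exact (((hu.comp measurable_fst).sub (hu.comp measurable_snd)).mul
    ((hv.comp measurable_fst).sub (hv.comp measurable_snd))).div (hd.pow_const s)

lemma jumpEnergy_lt_top_iff (s : ℝ) (u : Lp ℝ 2 μ) :
    jumpEnergy μ s u < ∞ ↔ Integrable (jumpDensity s u u) (μ.prod μ) := by
  have h : jumpEnergy μ s u = ∫⁻ p, ENNReal.ofReal (jumpDensity s u u p) ∂(μ.prod μ) := by
    simp only [jumpEnergy, jumpDensity_self]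
  rw [h, ← hasFiniteIntegral_iff_ofReal (ae_of_all _ (jumpDensity_self_nonneg s u))]
  exact ⟨fun h => ⟨(jumpDensity_measurable s u u).aestronglyMeasurable, h⟩, fun h => h.2⟩

lemma jumpDensity_integrable {s : ℝ} {u v : Lp ℝ 2 μ}
    (hu : jumpEnergy μ s u < ∞) (hv : jumpEnergy μ s v < ∞) :
    Integrable (jumpDensity s u v) (μ.prod μ) := by
  rw [jumpEnergy_lt_top_iff] at hu hv
  refine (hu.add hv).mono' (jumpDensity_measurable s u v).aestronglyMeasurable ?_
  exact ae_of_all _ (jumpDensity_abs_le s u v)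

variable (μ)

/-- The domain `{u ∈ L²(X; μ) : ∬ (u(x) - u(y))² / d(x,y)^s dμ(x) dμ(y) < ∞}`. -/
noncomputable def jumpDomain (s : ℝ) : Submodule ℝ (Lp ℝ 2 μ) where
  carrier := {u | jumpEnergy μ s u < ∞}
  zero_mem' := by
    rw [mem_ofPred_eq, jumpEnergy_lt_top_iff]
    refine (integrable_zero _ _ _).congr
      (EventuallyEq.trans ?_ (jumpDensity_congr s (Lp.coeFn_zero ℝ 2 μ) (Lp.coeFn_zero ℝ 2 μ)).symm)
    exact ae_of_all _ fun p => by simp [jumpDensity]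
  add_mem' := by
    intro u v hu hv
    have huv := jumpDensity_integrable hu hv
    rw [mem_ofPred_eq, jumpEnergy_lt_top_iff] at hu hv ⊢
    refine ((hu.add (huv.const_mul 2)).add hv).congr
      (EventuallyEq.trans ?_ (jumpDensity_congr s (Lp.coeFn_add u v) (Lp.coeFn_add u v)).symm)
    refine ae_of_all _ fun p => ?_
    simp only [jumpDensity, Pi.add_apply]
    ring
  smul_mem' := by
    intro c u hu
    rw [mem_ofPred_eq, jumpEnergy_lt_top_iff] at hu ⊢
    refine (hu.const_mul (c ^ 2)).congr
      (EventuallyEq.trans ?_ (jumpDensity_congr s (Lp.coeFn_smul c u) (Lp.coeFn_smul c u)).symm)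
    refine ae_of_all _ fun p => ?_
    simp only [jumpDensity, Pi.smul_apply, smul_eq_mul]
    ring

/-- The bilinear form `E(u,v) = ∬ (u(x) - u(y)) (v(x) - v(y)) / d(x,y)^s dμ(x) dμ(y)` on its
domain, where the integral converges absolutely. -/
noncomputable def jumpForm (s : ℝ) : jumpDomain μ s →ₗ[ℝ] jumpDomain μ s →ₗ[ℝ] ℝ :=
  LinearMap.mk₂ ℝ
    (fun u v => ∫ p, jumpDensity s (u : Lp ℝ 2 μ) (v : Lp ℝ 2 μ) p ∂(μ.prod μ))
    (fun u v w => by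
      rw [← integral_add (jumpDensity_integrable u.2 w.2) (jumpDensity_integrable v.2 w.2)]
      refine integral_congr_ae ((jumpDensity_congr s (Lp.coeFn_add _ _) ae_eq_rfl).trans ?_)
      exact ae_of_all _ fun p => jumpDensity_add_left s _ _ _ p)
    (fun c u w => by
      rw [smul_eq_mul, ← integral_const_mul]
      refine integral_congr_ae ((jumpDensity_congr s (Lp.coeFn_smul _ _) ae_eq_rfl).trans ?_)
      exact ae_of_all _ fun p => jumpDensity_smul_left s c _ _ p)
    (fun w u v => by
      rw [← integral_add (jumpDensity_integrable w.2 u.2) (jumpDensity_integrable w.2 v.2)]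
      refine integral_congr_ae ((jumpDensity_congr s ae_eq_rfl (Lp.coeFn_add _ _)).trans ?_)
      refine ae_of_all _ fun p => ?_
      simp only [jumpDensity, Pi.add_apply]; ring)
    (fun c w u => by
      rw [smul_eq_mul, ← integral_const_mul]
      refine integral_congr_ae ((jumpDensity_congr s ae_eq_rfl (Lp.coeFn_smul _ _)).trans ?_)
      refine ae_of_all _ fun p => ?_
      simp only [jumpDensity, Pi.smul_apply, smul_eq_mul]; ring)

/-- The diagonal of the form is the (finite) energy. -/
theorem ofReal_jumpForm_self (s : ℝ) (u : jumpDomain μ s) :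
    ENNReal.ofReal (jumpForm μ s u u) = jumpEnergy μ s (u : Lp ℝ 2 μ) := by
  have h : jumpForm μ s u u =
      ∫ p, jumpDensity s (u : Lp ℝ 2 μ) (u : Lp ℝ 2 μ) p ∂(μ.prod μ) := rfl
  rw [h, ofReal_integral_eq_lintegral_ofReal (jumpDensity_integrable u.2 u.2)
    (ae_of_all _ (jumpDensity_self_nonneg s _))]
  simp only [jumpEnergy, jumpDensity_self]

end JumpForm

/-! ### The Sierpiński gasket -/

/-- The corners `p₀ = (0,0)`, `p₁ = (1,0)`, `p₂ = (1/2, √3/2)`. -/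
noncomputable def gasketCorner : Fin 3 → EuclideanSpace ℝ (Fin 2) :=
  ![!₂[0, 0], !₂[1, 0], !₂[1 / 2, √3 / 2]]

/-- The contractions `fᵢ(x) = (x + pᵢ) / 2`. -/
noncomputable def gasketMap (i : Fin 3) (x : EuclideanSpace ℝ (Fin 2)) :
    EuclideanSpace ℝ (Fin 2) :=
  (1 / 2 : ℝ) • (x + gasketCorner i)

/-- The vertex sets: the corners, then `V_{n+1} = f₀(V_n) ∪ f₁(V_n) ∪ f₂(V_n)`. -/
noncomputable def gasketVertices : ℕ → Set (EuclideanSpace ℝ (Fin 2))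
  | 0 => range gasketCorner
  | n + 1 => ⋃ i, gasketMap i '' gasketVertices n

/-- The Sierpiński gasket `K`, the closure of the union of the vertex sets; equivalently, the
unique nonempty compact set with `K = f₀(K) ∪ f₁(K) ∪ f₂(K)`
(see `sierpinskiGasket_unique`). -/
noncomputable def sierpinskiGasket : Set (EuclideanSpace ℝ (Fin 2)) :=
  closure (⋃ n, gasketVertices n)

lemma gasketMap_continuous (i : Fin 3) : Continuous (gasketMap i) := by
  unfold gasketMap; fun_prop

lemma gasketMap_corner (i : Fin 3) : gasketMap i (gasketCorner i) = gasketCorner i := by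
  simp only [gasketMap, ← two_smul ℝ (gasketCorner i), smul_smul]; norm_num

lemma gasketMap_dist (i : Fin 3) (x y : EuclideanSpace ℝ (Fin 2)) :
    dist (gasketMap i x) (gasketMap i y) = dist x y / 2 := by
  simp only [gasketMap, dist_smul₀, dist_add_right]
  norm_num
  ring

lemma gasketVertices_bounded (n : ℕ) :
    ∀ x ∈ gasketVertices n, ‖x‖ ≤ ∑ i, ‖gasketCorner i‖ := by
  induction n with
  | zero =>
    rintro _ ⟨i, rfl⟩
    exact Finset.single_le_sum (f := fun i => ‖gasketCorner i‖) (fun _ _ => norm_nonneg _)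
      (Finset.mem_univ i)
  | succ n ih =>
    intro x hx
    obtain ⟨i, y, hy, rfl⟩ := mem_iUnion.1 hx
    have h1 := ih y hy
    have h2 : ‖gasketCorner i‖ ≤ ∑ i, ‖gasketCorner i‖ :=
      Finset.single_le_sum (f := fun i => ‖gasketCorner i‖) (fun _ _ => norm_nonneg _)
        (Finset.mem_univ i)
    have h3 := norm_add_le y (gasketCorner i)
    rw [gasketMap, norm_smul, Real.norm_of_nonneg (by norm_num)]
    linarith

theorem sierpinskiGasket_isCompact : IsCompact sierpinskiGasket := by
  refine Bornology.IsBounded.isCompact_closure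
    (isBounded_iff_forall_norm_le.2 ⟨∑ i, ‖gasketCorner i‖, fun x hx => ?_⟩)
  obtain ⟨n, hn⟩ := mem_iUnion.1 hx
  exact gasketVertices_bounded n x hn

instance sierpinskiGasket_compactSpace : CompactSpace sierpinskiGasket :=
  isCompact_iff_compactSpace.1 sierpinskiGasket_isCompact

theorem sierpinskiGasket_nonempty : sierpinskiGasket.Nonempty :=
  ⟨gasketCorner 0, subset_closure (mem_iUnion.2 ⟨0, mem_range_self 0⟩)⟩

theorem sierpinskiGasket_selfSimilar :
    sierpinskiGasket = ⋃ i, gasketMap i '' sierpinskiGasket := by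
  apply Subset.antisymm
  · refine closure_minimal ?_ (isClosed_iUnion_of_finite fun i =>
      (sierpinskiGasket_isCompact.image (gasketMap_continuous i)).isClosed)
    refine iUnion_subset fun n => ?_
    cases n with
    | zero =>
      rintro _ ⟨i, rfl⟩
      exact mem_iUnion.2 ⟨i, gasketCorner i,
        subset_closure (mem_iUnion.2 ⟨0, mem_range_self i⟩), gasketMap_corner i⟩
    | succ n =>
      exact iUnion_mono fun i => image_mono
        ((subset_iUnion gasketVertices n).trans subset_closure)
  · refine iUnion_subset fun i => ?_
    refine (image_closure_subset_closure_image (gasketMap_continuous i)).trans (closure_mono ?_)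
    rw [image_iUnion]
    exact iUnion_subset fun n => (subset_iUnion (fun i => gasketMap i '' gasketVertices n) i).trans
      (subset_iUnion gasketVertices (n + 1))

theorem sierpinskiGasket_unique {A : Set (EuclideanSpace ℝ (Fin 2))} (hne : A.Nonempty)
    (hA : IsCompact A) (hAs : A = ⋃ i, gasketMap i '' A) : A = sierpinskiGasket := by
  have key : ∀ {B C : Set (EuclideanSpace ℝ (Fin 2))}, B.Nonempty → IsCompact B → C.Nonempty →
      IsCompact C → B = ⋃ i, gasketMap i '' B → C = ⋃ i, gasketMap i '' C → B ⊆ C := by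
    intro B C hB hBc hC hCc hBs hCs
    obtain ⟨x, hx, hmax⟩ := hBc.exists_isMaxOn hB
      (Metric.continuous_infDist_pt C).continuousOn
    have hx' := hx
    rw [hBs] at hx'
    obtain ⟨i, y, hy, rfl⟩ := mem_iUnion.1 hx'
    obtain ⟨z, hz, hyz⟩ := hCc.exists_infDist_eq_dist hC y
    have hfz : gasketMap i z ∈ C := by
      rw [hCs]; exact mem_iUnion.2 ⟨i, z, hz, rfl⟩
    have h1 := Metric.infDist_le_dist_of_mem (x := gasketMap i y) hfz
    rw [gasketMap_dist, ← hyz] at h1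
    have h2 : Metric.infDist y C ≤ Metric.infDist (gasketMap i y) C := hmax hy
    have h3 : Metric.infDist (gasketMap i y) C ≤ 0 := by linarith
    intro b hb
    have h4 : Metric.infDist b C ≤ Metric.infDist (gasketMap i y) C := hmax hb
    exact (hCc.isClosed.mem_iff_infDist_zero hC).2
      (le_antisymm (h4.trans h3) Metric.infDist_nonneg)
  exact Subset.antisymm
    (key hne hA sierpinskiGasket_nonempty sierpinskiGasket_isCompact hAs
      sierpinskiGasket_selfSimilar)
    (key sierpinskiGasket_nonempty sierpinskiGasket_isCompact hne hA
      sierpinskiGasket_selfSimilar hAs)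

/-- The Hausdorff dimension `α = log 3 / log 2` of the gasket. -/
noncomputable def gasketDim : ℝ := Real.log 3 / Real.log 2

/-- The normalized `α`-dimensional Hausdorff measure `ν` on `K` (with the Euclidean metric). -/
noncomputable def gasketMeasure : Measure sierpinskiGasket :=
  (Measure.hausdorffMeasure gasketDim (univ : Set sierpinskiGasket))⁻¹ •
    Measure.hausdorffMeasure gasketDim

instance gasketMeasure_isFiniteMeasure : IsFiniteMeasure gasketMeasure := by
  refine ⟨?_⟩
  rw [gasketMeasure, Measure.smul_apply, smul_eq_mul]
  exact (ENNReal.inv_mul_le_one _).trans_lt ENNReal.one_lt_top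

/-! Write `s = α + β`. Closedness and the Markov property are soft: the energy is lower
semicontinuous in `L²` by Fatou, and a contraction of `u` shrinks every difference `u x - u y`.
Geometry enters only through regularity, and the two bounds on `β` play separate roles.

Lower bound. Since `β > α`, `s > 2α`. Balls of radius `r ≤ 1` have mass at least a constant times `r
^ α`, so Cauchy–Schwarz makes averages of a finite energy function over balls of radius `2⁻ⁿ`
converge geometrically. Hence it has a continuous version
(`exists_continuous_of_jumpEnergy_lt_top`), and continuous functions are trivially dense in the
domain.

Upper bound. Since `β < log 5 / log 2`, `2 ^ s < 15`, and harmonic functions have finite energy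
(`jumpEnergy_harmonicFun_lt_top`). Pairs off the diagonal are sorted by a cell of level `n` at which
their addresses split and a scale `m` at which they approach the junction of the two subcells. The
total graph energy over cells of level `n` is `(3/5) ^ n` times the initial one, and oscillations
decay like `(3/5) ^ m`, so the energy is dominated by geometric series of ratios `2 ^ s / 15` and `2
^ s / 25`. Harmonic functions separate points (`harmonicFun_separates`) and lie in the algebra of
continuous finite energy functions; Stone–Weierstrass gives density in `C(K)` and in `L²`.

The normalization of `ν` requires `0 < H^α(K) < ∞`: the cells give an efficient cover, and the
Bernoulli measure on addresses gives a mass distribution (`map_codingMap_le`). -/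

/-! ### Barycentric coordinates and cells of the gasket -/

/-- Barycentric coordinates with respect to the three corners. -/
noncomputable def bary (j : Fin 3) (x : EuclideanSpace ℝ (Fin 2)) : ℝ :=
  ![1 - x 0 - x 1 / √3, x 0 - x 1 / √3, 2 * (x 1 / √3)] j

lemma bary_sum (x : EuclideanSpace ℝ (Fin 2)) : ∑ j, bary j x = 1 := by
  simp only [bary, Fin.sum_univ_three, Matrix.cons_val]; ring

lemma bary_continuous (j : Fin 3) : Continuous (bary j) := by
  unfold bary; fin_cases j <;> simp only <;> fun_prop

lemma bary_corner (i j : Fin 3) : bary j (gasketCorner i) = if i = j then 1 else 0 := by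
  have h : √3 ≠ 0 := by positivity
  fin_cases i <;> fin_cases j <;> simp [bary, gasketCorner] <;> field_simp <;> norm_num

lemma bary_gasketMap (i j : Fin 3) (x : EuclideanSpace ℝ (Fin 2)) :
    bary j (gasketMap i x) = (bary j x + if i = j then 1 else 0) / 2 := by
  rw [← bary_corner]
  fin_cases j <;> simp [bary, gasketMap] <;> ring

lemma bary_ext {x y : EuclideanSpace ℝ (Fin 2)} (h1 : bary 1 x = bary 1 y)
    (h2 : bary 2 x = bary 2 y) : x = y := by
  have h : √3 ≠ 0 := by positivity
  simp only [bary, Matrix.cons_val] at h1 h2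
  have h3 : x 1 / √3 = y 1 / √3 := by linarith
  ext i
  fin_cases i
  · simp only [Fin.zero_eta]; linarith
  · simpa [div_left_inj' h] using h3

lemma abs_bary_sub_le (j : Fin 3) (x y : EuclideanSpace ℝ (Fin 2)) :
    |bary j x - bary j y| ≤ 2 * dist x y := by
  have h3 : 1 ≤ √3 := Real.one_le_sqrt.2 (by norm_num)
  have h33 : √3 ^ 2 = 3 := Real.sq_sqrt (by norm_num)
  have hd : dist x y ^ 2 = (x 0 - y 0) ^ 2 + (x 1 - y 1) ^ 2 := by
    rw [EuclideanSpace.dist_eq, Real.sq_sqrt (by positivity)]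
    simp [Fin.sum_univ_two, Real.dist_eq, sq_abs]
  have h0 : |x 0 - y 0| ≤ dist x y :=
    abs_le_of_sq_le_sq (by nlinarith [sq_nonneg (x 1 - y 1)]) dist_nonneg
  have h1 : |(x 1 - y 1) / √3| ≤ dist x y := by
    refine abs_le_of_sq_le_sq ?_ dist_nonneg
    rw [div_pow, h33, hd]
    nlinarith [sq_nonneg (x 1 - y 1), sq_nonneg (x 0 - y 0)]
  rw [sub_div] at h1
  rw [abs_le] at h0 h1 ⊢
  fin_cases j <;> simp only [bary] <;> constructor <;> simp <;> linarith

lemma bary_nonneg_of_mem {x : EuclideanSpace ℝ (Fin 2)} (hx : x ∈ sierpinskiGasket) (j : Fin 3) :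
    0 ≤ bary j x := by
  have hV : ∀ n, ∀ x ∈ gasketVertices n, ∀ j, 0 ≤ bary j x := by
    intro n
    induction n with
    | zero =>
      rintro _ ⟨i, rfl⟩ j
      rw [bary_corner]; split_ifs <;> norm_num
    | succ n ih =>
      intro x hx j
      obtain ⟨i, y, hy, rfl⟩ := mem_iUnion.1 hx
      have := ih y hy j
      rw [bary_gasketMap]; split_ifs <;> linarith
  refine closure_minimal (t := {x | 0 ≤ bary j x}) ?_
    (isClosed_le continuous_const (bary_continuous j)) hx
  exact iUnion_subset fun n x hx => hV n x hx j

lemma bary_nonneg (x : sierpinskiGasket) (j : Fin 3) : 0 ≤ bary j x := bary_nonneg_of_mem x.2 j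

lemma bary_le_one (x : sierpinskiGasket) (j : Fin 3) : bary j x ≤ 1 := by
  rw [← bary_sum x]
  exact Finset.single_le_sum (f := fun j => bary j (x : EuclideanSpace ℝ (Fin 2)))
    (fun i _ => bary_nonneg x i) (Finset.mem_univ j)

/-- The corners as points of the gasket. -/
noncomputable def cornerPt (i : Fin 3) : sierpinskiGasket :=
  ⟨gasketCorner i, subset_closure (mem_iUnion.2 ⟨0, mem_range_self i⟩)⟩

/-- The contractions as self-maps of the gasket. -/
noncomputable def gmap (i : Fin 3) (x : sierpinskiGasket) : sierpinskiGasket :=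
  ⟨gasketMap i x, sierpinskiGasket_selfSimilar.ge (mem_iUnion.2 ⟨i, x, x.2, rfl⟩)⟩

@[simp] lemma coe_gmap (i : Fin 3) (x : sierpinskiGasket) :
    (gmap i x : EuclideanSpace ℝ (Fin 2)) = gasketMap i x := rfl

lemma gmap_continuous (i : Fin 3) : Continuous (gmap i) :=
  ((gasketMap_continuous i).comp continuous_subtype_val).subtype_mk _

lemma dist_gmap (i : Fin 3) (x y : sierpinskiGasket) :
    dist (gmap i x) (gmap i y) = dist x y / 2 := gasketMap_dist i x y

lemma gmap_injective (i : Fin 3) : Function.Injective (gmap i) := by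
  intro x y h
  have h1 := dist_gmap i x y
  rw [h, dist_self] at h1
  exact dist_le_zero.1 (by linarith)

lemma gmap_cornerPt (i : Fin 3) : gmap i (cornerPt i) = cornerPt i :=
  Subtype.ext (gasketMap_corner i)

lemma bary_gmap (i j : Fin 3) (x : sierpinskiGasket) :
    bary j (gmap i x) = (bary j x + if i = j then 1 else 0) / 2 := bary_gasketMap i j x

lemma exists_gmap_eq (x : sierpinskiGasket) : ∃ i y, gmap i y = x := by
  obtain ⟨i, y, hy, h⟩ := mem_iUnion.1 (sierpinskiGasket_selfSimilar.le x.2)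
  exact ⟨i, ⟨y, hy⟩, Subtype.ext h⟩

lemma bary_sum_three (x : EuclideanSpace ℝ (Fin 2)) : bary 0 x + bary 1 x + bary 2 x = 1 := by
  rw [← bary_sum x, Fin.sum_univ_three]

lemma eq_cornerPt_of_bary {x : sierpinskiGasket} {j : Fin 3} (h : 1 ≤ bary j x) :
    x = cornerPt j := by
  have hs := bary_sum_three x
  have h0 := bary_nonneg x 0
  have h1 := bary_nonneg x 1
  have h2 := bary_nonneg x 2
  apply Subtype.ext
  apply bary_ext <;> simp only [cornerPt, bary_corner] <;> fin_cases j <;> simp at h ⊢ <;> linarith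

/-- The `j`-th coordinate is at most `1/2` on cell `i` and at least `1/2` on cell `j`, so a common
point has it equal to `1/2`; symmetrically for `i`. Distinct first-level cells thus meet in at most
one point. -/
lemma gmap_eq_gmap {i j : Fin 3} (hij : i ≠ j) {x y : sierpinskiGasket}
    (h : gmap i x = gmap j y) : x = cornerPt j ∧ y = cornerPt i := by
  have h1 := bary_gmap i j x
  have h2 := bary_gmap j j y
  have h3 := bary_gmap i i x
  have h4 := bary_gmap j i y
  rw [h] at h1 h3
  simp only [if_true, if_neg hij, if_neg hij.symm] at h1 h2 h3 h4
  have h5 := bary_nonneg y j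
  have h6 := bary_nonneg x i
  exact ⟨eq_cornerPt_of_bary (by linarith), eq_cornerPt_of_bary (by linarith)⟩

/-- Both sides are the midpoint of two corners: the junction of cells `i` and `j`. -/
lemma gmap_cornerPt_comm (i j : Fin 3) : gmap i (cornerPt j) = gmap j (cornerPt i) := by
  apply Subtype.ext
  apply bary_ext <;> simp only [bary_gmap] <;> simp [cornerPt, bary_corner, add_comm]

lemma dist_le_two (x y : sierpinskiGasket) : dist x y ≤ 2 := by
  have h3 : √3 ≤ 2 := by rw [Real.sqrt_le_left (by norm_num)]; norm_num
  have h33 : √3 ^ 2 = 3 := Real.sq_sqrt (by norm_num)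
  have hp : 0 < √3 := by positivity
  have hb : ∀ z : sierpinskiGasket, ‖(z : EuclideanSpace ℝ (Fin 2))‖ ≤ 1 := by
    intro z
    have hs := bary_sum_three z
    have h0 := bary_nonneg z 0
    have h1 := bary_nonneg z 1
    have h2 := bary_nonneg z 2
    rw [EuclideanSpace.norm_eq, Real.sqrt_le_one]
    have e1 : (z : EuclideanSpace ℝ (Fin 2)) 1 = √3 * (bary 2 z / 2) := by
      simp only [bary, Matrix.cons_val]; field_simp
    have e0 : (z : EuclideanSpace ℝ (Fin 2)) 0 = bary 1 z + bary 2 z / 2 := by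
      simp only [bary, Matrix.cons_val]; ring
    simp only [Fin.sum_univ_two, Real.norm_eq_abs, sq_abs, e0, e1, mul_pow, h33]
    nlinarith [mul_nonneg h1 h2, mul_nonneg h0 h1, mul_nonneg h0 h2]
  have := dist_le_norm_add_norm (x : EuclideanSpace ℝ (Fin 2)) y
  have h1 := hb x
  have h2 := hb y
  rw [Subtype.dist_eq]; linarith

/-- The composition `f_{w₀} ∘ ⋯ ∘ f_{w_{n-1}}` on the gasket. -/
noncomputable def cellMap : {n : ℕ} → (Fin n → Fin 3) → sierpinskiGasket → sierpinskiGasket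
  | 0, _, x => x
  | _ + 1, w, x => gmap (w 0) (cellMap (Fin.tail w) x)

lemma dist_cellMap {n : ℕ} (w : Fin n → Fin 3) (x y : sierpinskiGasket) :
    dist (cellMap w x) (cellMap w y) = dist x y * (1 / 2) ^ n := by
  induction n with
  | zero => simp [cellMap]
  | succ n ih => rw [cellMap, cellMap, dist_gmap, ih]; ring

lemma cellMap_continuous {n : ℕ} (w : Fin n → Fin 3) : Continuous (cellMap w) := by
  induction n with
  | zero => exact continuous_id
  | succ n ih => exact (gmap_continuous _).comp (ih _)

lemma exists_cellMap_eq (n : ℕ) (x : sierpinskiGasket) :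
    ∃ (w : Fin n → Fin 3) (y : sierpinskiGasket), cellMap w y = x := by
  induction n generalizing x with
  | zero => exact ⟨Fin.elim0, x, rfl⟩
  | succ n ih =>
    obtain ⟨i, z, rfl⟩ := exists_gmap_eq x
    obtain ⟨w, y, rfl⟩ := ih z
    exact ⟨Fin.cons i w, y, by simp [cellMap]⟩

lemma range_cellMap_isClosed {n : ℕ} (w : Fin n → Fin 3) : IsClosed (range (cellMap w)) :=
  (isCompact_range (cellMap_continuous w)).isClosed

/-- The bound `2 * (1/2) ^ n` is the diameter estimate for an `n`-cell, so points are identified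
below by induction on the scale. -/
lemma eq_of_forall_dist_le_pow {x y : sierpinskiGasket}
    (h : ∀ n : ℕ, dist x y ≤ 2 * (1 / 2 : ℝ) ^ n) : x = y := by
  have ht : Tendsto (fun n : ℕ => 2 * (1 / 2 : ℝ) ^ n) atTop (𝓝 (2 * 0)) :=
    (tendsto_pow_atTop_nhds_zero_of_lt_one (by norm_num) (by norm_num)).const_mul 2
  rw [mul_zero] at ht
  exact dist_le_zero.1 (ge_of_tendsto' ht h)

/-! ### Counting cells -/

/-- The integer translation part of `cellMap w` in the `j`-th barycentric coordinate. -/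
def cellCode : {n : ℕ} → (Fin n → Fin 3) → Fin 3 → ℤ
  | 0, _, _ => 0
  | n + 1, w, j => cellCode (Fin.tail w) j + if w 0 = j then 2 ^ n else 0

lemma bary_cellMap {n : ℕ} (w : Fin n → Fin 3) (j : Fin 3) (x : sierpinskiGasket) :
    2 ^ n * bary j (cellMap w x) = bary j x + cellCode w j := by
  induction n with
  | zero => simp [cellMap, cellCode]
  | succ n ih =>
    have := ih (Fin.tail w)
    rw [cellMap, bary_gmap, cellCode]
    split_ifs <;> push_cast <;> rw [pow_succ] <;> linarith

lemma cellMap_injective {n : ℕ} (w : Fin n → Fin 3) : Function.Injective (cellMap w) := by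
  induction n with
  | zero => exact Function.injective_id
  | succ n ih => exact (gmap_injective _).comp (ih _)

lemma cornerPt_injective : Function.Injective cornerPt := by
  intro i j h
  have h1 : bary i (cornerPt i) = bary i (cornerPt j) := by rw [h]
  simp only [cornerPt, bary_corner, if_true] at h1
  by_contra hij
  rw [if_neg (Ne.symm hij)] at h1
  norm_num at h1

lemma word_eq_of_cellMap_eq {n : ℕ} {w v : Fin n → Fin 3} (h : ∀ x, cellMap w x = cellMap v x) :
    w = v := by
  induction n with
  | zero => exact Subsingleton.elim _ _
  | succ n ih =>
    have h0 : w 0 = v 0 := by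
      by_contra hne
      -- If the first letters differed, two distinct corners would both be sent to the only possible
      -- junction point, against injectivity.
      have h1 := (gmap_eq_gmap hne (h (cornerPt 0))).1
      have h2 := (gmap_eq_gmap hne (h (cornerPt 1))).1
      exact absurd (cornerPt_injective (cellMap_injective _ (h1.trans h2.symm))) (by decide)
    have ht : Fin.tail w = Fin.tail v := by
      refine ih fun x => gmap_injective (w 0) ?_
      have := h x
      rwa [cellMap, cellMap, ← h0] at this
    rw [← Fin.cons_self_tail w, ← Fin.cons_self_tail v, h0, ht]

/-- Counting cells is thereby reduced to counting integer points. -/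
lemma cellCode_injective (n : ℕ) :
    Function.Injective (cellCode : (Fin n → Fin 3) → Fin 3 → ℤ) := by
  intro w v h
  refine word_eq_of_cellMap_eq fun x => Subtype.ext ?_
  have key : ∀ j, bary j (cellMap w x) = bary j (cellMap v x) := by
    intro j
    have h1 := bary_cellMap w j x
    rw [h, ← bary_cellMap v j x] at h1
    exact mul_left_cancel₀ (by positivity) h1
  exact bary_ext (key 1) (key 2)

open Classical in
/-- The `n`-cells that meet a set. -/
noncomputable def cellsMeeting (n : ℕ) (U : Set sierpinskiGasket) : Finset (Fin n → Fin 3) :=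
  Finset.univ.filter fun w => (range (cellMap w) ∩ U).Nonempty

/-- The point is that the bound does not depend on `n`. Scaled by `2 ^ n`, barycentric coordinates
vary by at most 2 over `U`, and a code differs from the scaled coordinate of a point of its cell by
at most 1. Each code entry therefore has 6 possible values, and `216 = 6 ^ 3`. -/
lemma card_cellsMeeting_le (n : ℕ) {U : Set sierpinskiGasket}
    (hU : ∀ x ∈ U, ∀ y ∈ U, dist x y ≤ (1 / 2) ^ n) : (cellsMeeting n U).card ≤ 216 := by
  rcases U.eq_empty_or_nonempty with rfl | ⟨x₀, hx₀⟩
  · simp [cellsMeeting]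
  set b : Fin 3 → ℤ := fun j => ⌊2 ^ n * bary j (x₀ : EuclideanSpace ℝ (Fin 2))⌋
  have hcard : (Fintype.piFinset fun j => Finset.Icc (b j - 3) (b j + 2)).card = 216 := by
    rw [Fintype.card_piFinset, Fin.prod_univ_three]
    simp only [Int.card_Icc]
    have : ∀ z : ℤ, (z + 2 + 1 - (z - 3)).toNat = 6 := fun z => by
      rw [show z + 2 + 1 - (z - 3) = 6 by ring]; rfl
    simp only [this]
    norm_num
  rw [← hcard]
  refine Finset.card_le_card_of_injOn cellCode ?_ (cellCode_injective n).injOn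
  intro w hw
  simp only [cellsMeeting, Finset.coe_filter, Finset.mem_univ, true_and, mem_ofPred_eq] at hw
  obtain ⟨_, ⟨y, rfl⟩, hy⟩ := hw
  simp only [Finset.mem_coe, Fintype.mem_piFinset, Finset.mem_Icc]
  intro j
  have h1 := bary_cellMap w j y
  have h2 : |bary j (x₀ : EuclideanSpace ℝ (Fin 2)) - bary j (cellMap w y)| ≤ 2 * (1 / 2) ^ n :=
    (abs_bary_sub_le j _ _).trans (by
      have := hU _ hx₀ _ hy
      rw [Subtype.dist_eq] at this; linarith)
  have h3 : |2 ^ n * bary j (x₀ : EuclideanSpace ℝ (Fin 2)) -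
      2 ^ n * bary j (cellMap w y)| ≤ 2 := by
    rw [← mul_sub, abs_mul, abs_of_nonneg (by positivity : (0 : ℝ) ≤ 2 ^ n)]
    calc _ ≤ (2 : ℝ) ^ n * (2 * (1 / 2) ^ n) := by gcongr
      _ = 2 * (2 * (1 / 2)) ^ n := by rw [mul_pow]; ring
      _ = 2 := by norm_num
  have h4 := bary_nonneg y j
  have h5 := bary_le_one y j
  rw [h1, abs_le] at h3
  have h6 := Int.floor_le (2 ^ n * bary j (x₀ : EuclideanSpace ℝ (Fin 2)))
  have h7 := Int.lt_floor_add_one (2 ^ n * bary j (x₀ : EuclideanSpace ℝ (Fin 2)))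
  constructor
  · have : ((b j - 4 : ℤ) : ℝ) < cellCode w j := by push_cast; simp only [b]; linarith
    have := Int.cast_lt.1 this
    linarith
  · have : ((cellCode w j : ℤ) : ℝ) < ((b j + 3 : ℤ) : ℝ) := by push_cast; simp only [b]; linarith
    have := Int.cast_lt.1 this
    linarith

/-! ### The Hausdorff measure of the gasket -/

lemma gasketDim_pos : 0 < gasketDim :=
  div_pos (Real.log_pos (by norm_num)) (Real.log_pos (by norm_num))

lemma two_rpow_gasketDim : (2 : ℝ) ^ gasketDim = 3 :=
  Real.rpow_logb (by norm_num) (by norm_num) (by norm_num)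

lemma half_pow_rpow_gasketDim (n : ℕ) : ((1 / 2 : ℝ) ^ n) ^ gasketDim = (1 / 3) ^ n := by
  rw [← Real.rpow_natCast, ← Real.rpow_mul (by norm_num), mul_comm, Real.rpow_mul (by norm_num),
    Real.rpow_natCast, Real.div_rpow (by norm_num) (by norm_num), Real.one_rpow,
    two_rpow_gasketDim]

lemma ofReal_half_pow_rpow (n : ℕ) :
    ENNReal.ofReal ((1 / 2 : ℝ) ^ n) ^ gasketDim = 3⁻¹ ^ n := by
  rw [ENNReal.ofReal_rpow_of_nonneg (by positivity) gasketDim_pos.le, half_pow_rpow_gasketDim,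
    ENNReal.ofReal_pow (by norm_num), one_div, ENNReal.ofReal_inv_of_pos (by norm_num),
    ENNReal.ofReal_ofNat]

/-- The Lipschitz and antilipschitz bounds match for a similarity, and `2 ^ α = 3`. -/
lemma hausdorffMeasure_range_of_dist {n : ℕ} {φ : sierpinskiGasket → sierpinskiGasket}
    (hφ : ∀ x y, dist (φ x) (φ y) = dist x y * (1 / 2) ^ n) :
    Measure.hausdorffMeasure gasketDim (range φ) =
      3⁻¹ ^ n * Measure.hausdorffMeasure gasketDim (univ : Set sierpinskiGasket) := by
  rw [← image_univ]
  apply le_antisymm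
  · have hL : LipschitzWith (Real.toNNReal ((1 / 2) ^ n)) φ := by
      refine LipschitzWith.of_dist_le_mul fun x y => ?_
      rw [hφ, Real.coe_toNNReal _ (by positivity), mul_comm]
    have := hL.hausdorffMeasure_image_le gasketDim_pos.le univ
    rwa [← ENNReal.ofReal, ofReal_half_pow_rpow] at this
  · have hA : AntilipschitzWith (Real.toNNReal (2 ^ n)) φ := by
      refine AntilipschitzWith.of_le_mul_dist fun x y => ?_
      rw [hφ, Real.coe_toNNReal _ (by positivity)]
      have : (2 : ℝ) ^ n * (1 / 2) ^ n = 1 := by rw [← mul_pow]; norm_num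
      rw [mul_left_comm, this, mul_one]
    have := hA.le_hausdorffMeasure_image gasketDim_pos.le univ
    rw [← ENNReal.ofReal] at this
    have e : ENNReal.ofReal (2 ^ n) ^ gasketDim = 3 ^ n := by
      rw [ENNReal.ofReal_rpow_of_nonneg (by positivity) gasketDim_pos.le, ← Real.rpow_natCast,
        ← Real.rpow_mul (by norm_num), mul_comm, Real.rpow_mul (by norm_num), Real.rpow_natCast,
        two_rpow_gasketDim, ENNReal.ofReal_pow (by norm_num), ENNReal.ofReal_ofNat]
    rw [e] at this
    calc _ ≤ 3⁻¹ ^ n * (3 ^ n * Measure.hausdorffMeasure gasketDim (φ '' univ)) := by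
          gcongr
      _ = _ := by
          rw [← mul_assoc, ← mul_pow, ENNReal.inv_mul_cancel (by norm_num) (by norm_num), one_pow,
            one_mul]

/-- The `3 ^ n` cells of level `n` have diameter at most `2 * 2⁻ⁿ`, so their `α`-sums are bounded by
`2 ^ α = 3`, uniformly in `n`. -/
lemma hausdorffMeasure_gasket_lt_top :
    Measure.hausdorffMeasure gasketDim (univ : Set sierpinskiGasket) < ∞ := by
  have hd : ∀ (n : ℕ) (w : Fin n → Fin 3),
      Metric.ediam (range (cellMap w)) ≤ 2 * ENNReal.ofReal ((1 / 2) ^ n) := by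
    intro n w
    refine Metric.ediam_le ?_
    rintro _ ⟨x, rfl⟩ _ ⟨y, rfl⟩
    have e : (2 : ℝ≥0∞) * ENNReal.ofReal ((1 / 2) ^ n) = ENNReal.ofReal (2 * (1 / 2) ^ n) := by
      rw [ENNReal.ofReal_mul (by norm_num), ENNReal.ofReal_ofNat]
    rw [edist_dist, dist_cellMap, e]
    have := dist_le_two x y
    gcongr
  have ht : Tendsto (fun n : ℕ => 2 * ENNReal.ofReal ((1 / 2) ^ n)) atTop (𝓝 0) := by
    have h1 : Tendsto (fun n : ℕ => ENNReal.ofReal ((1 / 2) ^ n)) atTop (𝓝 0) := by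
      rw [← ENNReal.ofReal_zero]
      exact ENNReal.tendsto_ofReal
        (tendsto_pow_atTop_nhds_zero_of_lt_one (by norm_num) (by norm_num))
    simpa using ENNReal.Tendsto.const_mul h1 (Or.inr (by norm_num))
  refine (Measure.hausdorffMeasure_le_liminf_sum (ι := fun n => Fin n → Fin 3) gasketDim univ
    (l := atTop) _ ht (fun n w => range (cellMap w)) (Eventually.of_forall hd)
    (Eventually.of_forall fun n x _ => ?_)).trans_lt ?_
  · obtain ⟨w, y, h⟩ := exists_cellMap_eq n x
    exact mem_iUnion.2 ⟨w, y, h⟩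
  · refine lt_of_le_of_lt (liminf_le_liminf (v := fun _ => 3) (Eventually.of_forall fun n => ?_)) ?_
    · calc ∑ w : Fin n → Fin 3, Metric.ediam (range (cellMap w)) ^ gasketDim
          ≤ ∑ w : Fin n → Fin 3, (2 * ENNReal.ofReal ((1 / 2) ^ n)) ^ gasketDim :=
            Finset.sum_le_sum fun w _ => ENNReal.rpow_le_rpow (hd n w) gasketDim_pos.le
        _ = 3 := by
          rw [ENNReal.mul_rpow_of_nonneg _ _ gasketDim_pos.le, ofReal_half_pow_rpow,
            ← ENNReal.ofReal_ofNat 2, ENNReal.ofReal_rpow_of_nonneg (by norm_num) gasketDim_pos.le,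
            two_rpow_gasketDim, Finset.sum_const, Finset.card_univ, Fintype.card_fun,
            Fintype.card_fin, Fintype.card_fin, nsmul_eq_mul, ENNReal.ofReal_ofNat, mul_left_comm]
          push_cast
          rw [← mul_pow, ENNReal.mul_inv_cancel (by norm_num) (by norm_num), one_pow, mul_one]
    · rw [liminf_const]; norm_num

/-- The first `n` letters of an infinite word. -/
def wordPrefix (n : ℕ) (ω : ℕ → Fin 3) : Fin n → Fin 3 := fun k => ω k

lemma cellMap_cons {n : ℕ} (i : Fin 3) (w : Fin n → Fin 3) (x : sierpinskiGasket) :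
    cellMap (Fin.cons i w : Fin (n + 1) → Fin 3) x = gmap i (cellMap w x) := by
  simp [cellMap]

lemma cellMap_snoc {n : ℕ} (w : Fin n → Fin 3) (i : Fin 3) (x : sierpinskiGasket) :
    cellMap (Fin.snoc w i : Fin (n + 1) → Fin 3) x = cellMap w (gmap i x) := by
  induction n with
  | zero => simp [cellMap, Fin.snoc]
  | succ n ih =>
    have e : (Fin.snoc w i : Fin (n + 2) → Fin 3) =
        Fin.cons (w 0) (Fin.snoc (Fin.tail w) i : Fin (n + 1) → Fin 3) := by
      rw [Fin.cons_snoc_eq_snoc_cons, Fin.cons_self_tail]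
    rw [e, cellMap_cons, ih, cellMap]

lemma wordPrefix_succ (n : ℕ) (ω : ℕ → Fin 3) :
    wordPrefix (n + 1) ω = Fin.snoc (wordPrefix n ω) (ω n) := by
  ext k
  refine Fin.lastCases ?_ (fun k => ?_) k <;> simp [wordPrefix]

/-- A point of the `n`-cell with address given by an infinite word. -/
noncomputable def cellPoint (ω : ℕ → Fin 3) (n : ℕ) : sierpinskiGasket :=
  cellMap (wordPrefix n ω) (cornerPt 0)

lemma cellPoint_mem (ω : ℕ → Fin 3) {n m : ℕ} (h : n ≤ m) :
    cellPoint ω m ∈ range (cellMap (wordPrefix n ω)) := by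
  have : Antitone fun n => range (cellMap (wordPrefix n ω)) := by
    refine antitone_nat_of_succ_le fun n => ?_
    rintro _ ⟨x, rfl⟩
    rw [wordPrefix_succ, cellMap_snoc]
    exact mem_range_self _
  exact this h (mem_range_self _)

lemma cellPoint_cauchySeq (ω : ℕ → Fin 3) : CauchySeq (cellPoint ω) := by
  refine cauchySeq_of_le_geometric (1 / 2) 2 (by norm_num) fun n => ?_
  obtain ⟨x, hx⟩ := cellPoint_mem ω n.le_succ
  rw [← hx, cellPoint, dist_cellMap]
  have := dist_le_two (cornerPt 0) x
  gcongr

/-- The coding map from infinite words to the gasket. -/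
noncomputable def codingMap (ω : ℕ → Fin 3) : sierpinskiGasket :=
  (cauchySeq_tendsto_of_complete (cellPoint_cauchySeq ω)).choose

lemma codingMap_tendsto (ω : ℕ → Fin 3) : Tendsto (cellPoint ω) atTop (𝓝 (codingMap ω)) :=
  (cauchySeq_tendsto_of_complete (cellPoint_cauchySeq ω)).choose_spec

lemma codingMap_mem (ω : ℕ → Fin 3) (n : ℕ) :
    codingMap ω ∈ range (cellMap (wordPrefix n ω)) :=
  (range_cellMap_isClosed _).mem_of_tendsto (codingMap_tendsto ω)
    ((eventually_ge_atTop n).mono fun _ h => cellPoint_mem ω h)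

lemma codingMap_measurable : Measurable codingMap := by
  refine measurable_of_tendsto_metrizable (f := fun n ω => cellPoint ω n) (fun n => ?_)
    (tendsto_pi_nhds.2 codingMap_tendsto)
  have h1 : Measurable (wordPrefix n) := measurable_pi_lambda _ fun k => measurable_pi_apply _
  exact (measurable_of_finite fun w : Fin n → Fin 3 => cellMap w (cornerPt 0)).comp h1

/-- The uniform Bernoulli measure on infinite words. -/
noncomputable def bernoulliMeasure : Measure (ℕ → Fin 3) :=
  Measure.infinitePi fun _ => (PMF.uniformOfFintype (Fin 3)).toMeasure

lemma bernoulliMeasure_univ : bernoulliMeasure univ = 1 := by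
  unfold bernoulliMeasure; exact measure_univ

lemma bernoulliMeasure_cylinder {n : ℕ} (w : Fin n → Fin 3) :
    bernoulliMeasure {ω | wordPrefix n ω = w} = 3⁻¹ ^ n := by
  rcases Nat.eq_zero_or_pos n with rfl | hn
  · have : {ω : ℕ → Fin 3 | wordPrefix 0 ω = w} = univ :=
      eq_univ_of_forall fun ω => Subsingleton.elim _ _
    rw [this, bernoulliMeasure_univ, pow_zero]
  -- The index `k % n` only serves to extend `w` to all of `ℕ`; it equals `k` for the relevant `k <
  -- n`.
  have hset : {ω : ℕ → Fin 3 | wordPrefix n ω = w} =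
      ((Finset.range n : Finset ℕ) : Set ℕ).pi fun k => {w ⟨k % n, Nat.mod_lt _ hn⟩} := by
    ext ω
    simp only [mem_ofPred_eq, Set.mem_pi, Finset.coe_range, mem_Iio, mem_singleton_iff]
    constructor
    · rintro rfl k hk
      simp [wordPrefix, Nat.mod_eq_of_lt hk]
    · intro h
      ext k
      have := h k k.2
      simp only [Nat.mod_eq_of_lt k.2] at this
      simp [wordPrefix, this]
  rw [hset, bernoulliMeasure, Measure.infinitePi_pi _ fun _ _ => measurableSet_singleton _]
  simp

/-- A word coded into `U` has an `n`-prefix whose cell meets `U`; at most 216 prefixes qualify, each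
of mass `3⁻ⁿ`. -/
lemma bernoulliMeasure_preimage_le (n : ℕ) {U : Set sierpinskiGasket}
    (hU : ∀ x ∈ U, ∀ y ∈ U, dist x y ≤ (1 / 2) ^ n) :
    bernoulliMeasure (codingMap ⁻¹' U) ≤ 216 * 3⁻¹ ^ n := by
  calc bernoulliMeasure (codingMap ⁻¹' U)
      ≤ bernoulliMeasure (⋃ w ∈ cellsMeeting n U, {ω | wordPrefix n ω = w}) := by
        refine measure_mono fun ω hω => ?_
        simp only [mem_iUnion, exists_prop, mem_ofPred_eq, exists_eq_right', cellsMeeting,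
          Finset.mem_filter, Finset.mem_univ, true_and]
        exact ⟨codingMap ω, codingMap_mem ω n, hω⟩
    _ ≤ ∑ w ∈ cellsMeeting n U, bernoulliMeasure {ω | wordPrefix n ω = w} :=
        measure_biUnion_finset_le _ _
    _ = (cellsMeeting n U).card * 3⁻¹ ^ n := by
        simp only [bernoulliMeasure_cylinder, Finset.sum_const, nsmul_eq_mul]
    _ ≤ 216 * 3⁻¹ ^ n := by
        gcongr
        exact_mod_cast card_cellsMeeting_le n hU

lemma exists_half_pow_bounds {r : ℝ} (h0 : 0 < r) (h1 : r ≤ 1) :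
    ∃ n : ℕ, r ≤ (1 / 2) ^ n ∧ (1 / 2) ^ n < 2 * r := by
  obtain ⟨n, hn, hn'⟩ := exists_nat_pow_near_of_lt_one h0 h1 (y := (1 / 2 : ℝ)) (by norm_num)
    (by norm_num)
  exact ⟨n, hn', by rw [pow_succ] at hn; linarith⟩

/-- Mass distribution principle. The constant is `648 = 216 * 3`: the number of cells times the loss
`2 ^ α = 3` from rounding a diameter up to a power of `1/2`. -/
lemma map_codingMap_le :
    (648 : ℝ≥0∞)⁻¹ • bernoulliMeasure.map codingMap ≤ Measure.hausdorffMeasure gasketDim := by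
  refine Measure.le_hausdorffMeasure _ _ 1 one_pos fun U hU => ?_
  rw [Measure.smul_apply, smul_eq_mul]
  -- Passing to the closure keeps the diameter and makes the set measurable.
  have hfin : Metric.ediam (closure U) ≠ ∞ := by
    rw [Metric.ediam_closure]; exact (hU.trans_lt ENNReal.one_lt_top).ne
  have hdist : ∀ x ∈ closure U, ∀ y ∈ closure U, dist x y ≤ Metric.diam (closure U) :=
    fun x hx y hy => Metric.dist_le_diam_of_mem' hfin hx hy
  have hed : Metric.ediam U = ENNReal.ofReal (Metric.diam (closure U)) := by
    rw [Metric.diam, ENNReal.ofReal_toReal hfin, Metric.ediam_closure]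
  have hmap : bernoulliMeasure.map codingMap U ≤ bernoulliMeasure (codingMap ⁻¹' closure U) := by
    rw [← Measure.map_apply codingMap_measurable isClosed_closure.measurableSet]
    exact measure_mono subset_closure
  refine le_trans (mul_le_mul_right hmap _) ?_
  have hd0 : 0 ≤ Metric.diam (closure U) := Metric.diam_nonneg
  -- A set of diameter zero has no dyadic scale, but the estimate at every level `n` shows that it
  -- carries no mass.
  rcases hd0.eq_or_lt with h0 | h0
  · have hz : bernoulliMeasure (codingMap ⁻¹' closure U) ≤ 0 := by
      have ht : Tendsto (fun n : ℕ => 216 * (3⁻¹ : ℝ≥0∞) ^ n) atTop (𝓝 (216 * 0)) :=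
        ENNReal.Tendsto.const_mul (ENNReal.tendsto_pow_atTop_nhds_zero_of_lt_one (by norm_num))
          (Or.inr (by norm_num))
      rw [mul_zero] at ht
      refine ge_of_tendsto' ht fun n => bernoulliMeasure_preimage_le n fun x hx y hy => ?_
      exact (hdist x hx y hy).trans (h0 ▸ by positivity)
    rw [nonpos_iff_eq_zero.1 hz, mul_zero]
    exact zero_le
  · have h1 : Metric.diam (closure U) ≤ 1 := by
      rw [hed] at hU
      exact ENNReal.ofReal_le_one.1 hU
    obtain ⟨n, hn, hn'⟩ := exists_half_pow_bounds h0 h1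
    have hb := bernoulliMeasure_preimage_le n fun x hx y hy => (hdist x hx y hy).trans hn
    have h3 : (3⁻¹ : ℝ≥0∞) ^ n ≤ 3 * Metric.ediam U ^ gasketDim := by
      rw [← ofReal_half_pow_rpow, hed]
      calc ENNReal.ofReal ((1 / 2) ^ n) ^ gasketDim
          ≤ (ENNReal.ofReal 2 * ENNReal.ofReal (Metric.diam (closure U))) ^ gasketDim := by
            rw [← ENNReal.ofReal_mul (by norm_num)]
            exact ENNReal.rpow_le_rpow (ENNReal.ofReal_le_ofReal hn'.le) gasketDim_pos.le
        _ = _ := by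
          rw [ENNReal.mul_rpow_of_nonneg _ _ gasketDim_pos.le,
            ENNReal.ofReal_rpow_of_nonneg (by norm_num) gasketDim_pos.le, two_rpow_gasketDim,
            ENNReal.ofReal_ofNat]
    calc (648 : ℝ≥0∞)⁻¹ * bernoulliMeasure (codingMap ⁻¹' closure U)
        ≤ 648⁻¹ * (216 * (3 * Metric.ediam U ^ gasketDim)) := by
          gcongr
          exact hb.trans (by gcongr)
      _ = Metric.ediam U ^ gasketDim := by
          rw [← mul_assoc, ← mul_assoc, mul_assoc (648⁻¹ : ℝ≥0∞), show (216 * 3 : ℝ≥0∞) = 648 by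
            norm_num, ENNReal.inv_mul_cancel (by norm_num) (by norm_num), one_mul]

lemma hausdorffMeasure_gasket_ne_zero :
    Measure.hausdorffMeasure gasketDim (univ : Set sierpinskiGasket) ≠ 0 := by
  have h := map_codingMap_le univ
  rw [Measure.smul_apply, smul_eq_mul, Measure.map_apply codingMap_measurable MeasurableSet.univ,
    preimage_univ, bernoulliMeasure_univ, mul_one] at h
  exact (lt_of_lt_of_le (by simp) h).ne'

/-! ### Regularity of the normalized measure -/

lemma gasketMeasure_range_of_dist {n : ℕ} {φ : sierpinskiGasket → sierpinskiGasket}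
    (hφ : ∀ x y, dist (φ x) (φ y) = dist x y * (1 / 2) ^ n) :
    gasketMeasure (range φ) = 3⁻¹ ^ n := by
  rw [gasketMeasure, Measure.smul_apply, smul_eq_mul, hausdorffMeasure_range_of_dist hφ,
    mul_left_comm,
    ENNReal.inv_mul_cancel hausdorffMeasure_gasket_ne_zero hausdorffMeasure_gasket_lt_top.ne,
    mul_one]

/-- The ball contains an `n`-cell through `x`. -/
lemma le_gasketMeasure_closedBall (x : sierpinskiGasket) (n : ℕ) :
    3⁻¹ ^ n ≤ gasketMeasure (Metric.closedBall x (2 * (1 / 2) ^ n)) := by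
  obtain ⟨w, y, rfl⟩ := exists_cellMap_eq n x
  rw [← gasketMeasure_range_of_dist (dist_cellMap w)]
  refine measure_mono ?_
  rintro _ ⟨z, rfl⟩
  rw [Metric.mem_closedBall, dist_cellMap]
  have := dist_le_two z y
  gcongr

lemma gasketMeasure_isOpenPosMeasure : gasketMeasure.IsOpenPosMeasure := by
  refine ⟨fun U hU hne => ?_⟩
  obtain ⟨x, hx⟩ := hne
  obtain ⟨ε, hε, hball⟩ := Metric.isOpen_iff.1 hU x hx
  obtain ⟨n, hn⟩ := exists_pow_lt_of_lt_one (half_pos hε) (show (1 / 2 : ℝ) < 1 by norm_num)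
  have h1 : Metric.closedBall x (2 * (1 / 2) ^ n) ⊆ U :=
    (Metric.closedBall_subset_ball (by linarith)).trans hball
  exact (lt_of_lt_of_le (ENNReal.pow_pos (by simp) n)
    ((le_gasketMeasure_closedBall x n).trans (measure_mono h1))).ne'

/-! ### Finite energy functions are continuous -/

/-- Cauchy–Schwarz against the constant 1, obtained by integrating `(F - I / m) ^ 2 ≥ 0` with `I /
m` the mean of `F`. -/
lemma sq_integral_le_measureReal_mul {Z : Type*} [MeasurableSpace Z] {ρ : Measure Z}
    [IsFiniteMeasure ρ] {F : Z → ℝ} (hF : Integrable F ρ) (hF2 : Integrable (fun z => F z ^ 2) ρ) :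
    (∫ z, F z ∂ρ) ^ 2 ≤ ρ.real univ * ∫ z, F z ^ 2 ∂ρ := by
  rcases eq_or_ne (ρ.real univ) 0 with h0 | h0
  · have : ρ = 0 := by
      rwa [measureReal_eq_zero_iff, Measure.measure_univ_eq_zero] at h0
    simp [this]
  · have hm : 0 < ρ.real univ := lt_of_le_of_ne measureReal_nonneg h0.symm
    set m := ρ.real univ
    set I := ∫ z, F z ∂ρ
    have h1 : ∫ z, (2 * (I / m) * F z - (I / m) ^ 2) ∂ρ ≤ ∫ z, F z ^ 2 ∂ρ :=
      integral_mono ((hF.const_mul _).sub (integrable_const _)) hF2 fun z => by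
        nlinarith [sq_nonneg (F z - I / m)]
    rw [integral_sub (hF.const_mul _) (integrable_const _), integral_const_mul, integral_const,
      smul_eq_mul] at h1
    have h2 : 2 * (I / m) * I - m * (I / m) ^ 2 = I ^ 2 / m := by field_simp; ring
    change 2 * (I / m) * I - m * (I / m) ^ 2 ≤ _ at h1
    rw [h2, div_le_iff₀ hm] at h1
    linarith

section Embedding

variable {X : Type*} [MetricSpace X]

lemma sq_sub_le_mul_jumpDensity {s d : ℝ} (hs : 0 ≤ s) (u : X → ℝ) {p : X × X}
    (hp : dist p.1 p.2 ≤ d) : (u p.1 - u p.2) ^ 2 ≤ d ^ s * jumpDensity s u u p := by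
  rw [jumpDensity_self]
  rcases eq_or_ne p.1 p.2 with h | h
  · simp [h]
  · have h0 : 0 < dist p.1 p.2 := dist_pos.2 h
    have h1 : 0 < dist p.1 p.2 ^ s := Real.rpow_pos_of_pos h0 s
    rw [mul_div_assoc', le_div_iff₀ h1, mul_comm]
    gcongr

variable [MeasurableSpace X] {μ : Measure X} [IsFiniteMeasure μ]

/-- Cauchy–Schwarz in `y` alone, with `x` fixed. It identifies the limit of the averages with `u x`
at every point of finite inner energy, in place of a Lebesgue differentiation theorem. -/
lemma sq_sub_setAverage_le {s d : ℝ} (hs : 0 ≤ s) {u : X → ℝ} (hu : Integrable u μ)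
    {T : Set X} (hT : MeasurableSet T) (hT0 : 0 < μ.real T) {x : X}
    (hd : ∀ y ∈ T, dist x y ≤ d) (hx : Integrable (fun y => jumpDensity s u u (x, y)) μ) :
    (u x - ⨍ y in T, u y ∂μ) ^ 2 ≤ d ^ s * (∫ y, jumpDensity s u u (x, y) ∂μ) / μ.real T := by
  have hF : Integrable (fun y => u x - u y) (μ.restrict T) :=
    (integrable_const _).sub hu.integrableOn
  have hle : ∀ᵐ y ∂μ.restrict T, (u x - u y) ^ 2 ≤ d ^ s * jumpDensity s u u (x, y) := by
    filter_upwards [ae_restrict_mem hT] with y hy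
    exact sq_sub_le_mul_jumpDensity hs u (p := (x, y)) (hd y hy)
  have hF2 : Integrable (fun y => (u x - u y) ^ 2) (μ.restrict T) :=
    (hx.integrableOn.const_mul (d ^ s)).mono' (hF.aestronglyMeasurable.pow 2) (by
      filter_upwards [hle] with y hy
      rwa [Real.norm_of_nonneg (sq_nonneg _)])
  have h1 := sq_integral_le_measureReal_mul hF hF2
  rw [integral_sub (integrable_const _) hu.integrableOn, integral_const, smul_eq_mul,
    measureReal_restrict_apply_univ] at h1
  have h2 : ∫ y in T, (u x - u y) ^ 2 ∂μ ≤ d ^ s * ∫ y, jumpDensity s u u (x, y) ∂μ := by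
    rcases T.eq_empty_or_nonempty with rfl | ⟨y, hy⟩
    · simp at hT0
    have hd0 : 0 ≤ d := dist_nonneg.trans (hd y hy)
    rw [← integral_const_mul]
    refine (integral_mono_ae hF2 (hx.integrableOn.const_mul _) hle).trans ?_
    exact setIntegral_le_integral (hx.const_mul _)
      (ae_of_all _ fun y => mul_nonneg (by positivity) (jumpDensity_self_nonneg s u _))
  rw [setAverage_eq, smul_eq_mul, le_div_iff₀ hT0]
  have h3 : (u x - (μ.real T)⁻¹ * ∫ y in T, u y ∂μ) ^ 2 * μ.real T =
      (μ.real T * u x - ∫ y in T, u y ∂μ) ^ 2 / μ.real T := by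
    field_simp
  rw [h3, div_le_iff₀ hT0]
  nlinarith

variable [SecondCountableTopology X]

/-- Cauchy–Schwarz for `u x - u y` on `S ×ˢ T`, where the kernel is at least `d ^ (-s)` off the
diagonal. -/
lemma sq_setAverage_sub_setAverage_le {s d : ℝ} (hs : 0 ≤ s) {u : X → ℝ} (hu : Integrable u μ)
    {S T : Set X} (hS : MeasurableSet S) (hT : MeasurableSet T) (hS0 : 0 < μ.real S)
    (hT0 : 0 < μ.real T) (hd : ∀ x ∈ S, ∀ y ∈ T, dist x y ≤ d)
    (hE : Integrable (jumpDensity s u u) (μ.prod μ)) :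
    (⨍ y in S, u y ∂μ - ⨍ y in T, u y ∂μ) ^ 2 ≤
      d ^ s * (∫ p, jumpDensity s u u p ∂μ.prod μ) / (μ.real S * μ.real T) := by
  set ρ := (μ.prod μ).restrict (S ×ˢ T)
  have hρ : ρ = (μ.restrict S).prod (μ.restrict T) := (Measure.prod_restrict S T).symm
  have hi1 : Integrable (fun p : X × X => u p.1) ρ := by
    rw [hρ]; exact hu.integrableOn.comp_fst _
  have hi2 : Integrable (fun p : X × X => u p.2) ρ := by
    rw [hρ]; exact hu.integrableOn.comp_snd _
  have hF : Integrable (fun p : X × X => u p.1 - u p.2) ρ := hi1.sub hi2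
  have hle : ∀ᵐ p ∂ρ, (u p.1 - u p.2) ^ 2 ≤ d ^ s * jumpDensity s u u p := by
    filter_upwards [ae_restrict_mem (hS.prod hT)] with p hp
    exact sq_sub_le_mul_jumpDensity hs u (hd _ hp.1 _ hp.2)
  have hF2 : Integrable (fun p : X × X => (u p.1 - u p.2) ^ 2) ρ :=
    (hE.integrableOn.const_mul (d ^ s)).mono' (hF.aestronglyMeasurable.pow 2) (by
      filter_upwards [hle] with y hy
      rwa [Real.norm_of_nonneg (sq_nonneg _)])
  have h1 := sq_integral_le_measureReal_mul hF hF2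
  have hρu : ρ.real univ = μ.real S * μ.real T := by
    rw [measureReal_restrict_apply_univ, measureReal_prod_prod]
  have e1 : ∫ p, u p.1 ∂ρ = μ.real T * ∫ y in S, u y ∂μ := by
    rw [hρ, integral_fun_fst, measureReal_restrict_apply_univ, smul_eq_mul]
  have e2 : ∫ p, u p.2 ∂ρ = μ.real S * ∫ y in T, u y ∂μ := by
    rw [hρ, integral_fun_snd, measureReal_restrict_apply_univ, smul_eq_mul]
  rw [integral_sub hi1 hi2, hρu, e1, e2] at h1
  have h2 : ∫ p, (u p.1 - u p.2) ^ 2 ∂ρ ≤ d ^ s * ∫ p, jumpDensity s u u p ∂μ.prod μ := by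
    rcases S.eq_empty_or_nonempty with rfl | ⟨x, hx⟩
    · simp at hS0
    rcases T.eq_empty_or_nonempty with rfl | ⟨y, hy⟩
    · simp at hT0
    have hd0 : 0 ≤ d := dist_nonneg.trans (hd x hx y hy)
    rw [← integral_const_mul]
    refine (integral_mono_ae hF2 (hE.integrableOn.const_mul _) hle).trans ?_
    exact setIntegral_le_integral (hE.const_mul _)
      (ae_of_all _ fun y => mul_nonneg (by positivity) (jumpDensity_self_nonneg s u _))
  have hST := mul_pos hS0 hT0
  rw [setAverage_eq, setAverage_eq, smul_eq_mul, smul_eq_mul, le_div_iff₀ hST]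
  have h3 : ((μ.real S)⁻¹ * ∫ y in S, u y ∂μ - (μ.real T)⁻¹ * ∫ y in T, u y ∂μ) ^ 2 *
      (μ.real S * μ.real T) = (μ.real T * ∫ y in S, u y ∂μ - μ.real S * ∫ y in T, u y ∂μ) ^ 2 /
        (μ.real S * μ.real T) := by
    field_simp
  rw [h3, div_le_iff₀ hST]
  nlinarith

variable [BorelSpace X]

/-- On a space whose balls of radius `r ≤ 1` have measure at least `c r^α`, functions of finite
energy for an exponent `s > 2 α` have a continuous version. -/
theorem exists_continuous_of_jumpEnergy_lt_top {c α s : ℝ} (hc : 0 < c) (hα : 0 ≤ α)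
    (hs : 2 * α < s) (hball : ∀ (x : X) (r : ℝ), 0 < r → r ≤ 1 →
      c * r ^ α ≤ μ.real (Metric.closedBall x r)) (u : Lp ℝ 2 μ) (hu : jumpEnergy μ s u < ∞) :
    ∃ g : X → ℝ, Continuous g ∧ (u : X → ℝ) =ᵐ[μ] g := by
  have hs0 : 0 ≤ s := by linarith
  have hE : Integrable (jumpDensity s u u) (μ.prod μ) := (jumpEnergy_lt_top_iff s u).1 hu
  have hui : Integrable (u : X → ℝ) μ := (Lp.memLp u).integrable one_le_two
  have hpos : ∀ (x : X) (r : ℝ), 0 < r → r ≤ 1 → 0 < μ.real (Metric.closedBall x r) :=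
    fun x r h0 h1 => lt_of_lt_of_le (by positivity) (hball x r h0 h1)
  set E := ∫ p, jumpDensity s u u p ∂μ.prod μ with hEdef
  have hE0 : 0 ≤ E := integral_nonneg (jumpDensity_self_nonneg s u)
  set A : X → ℕ → ℝ := fun x n => ⨍ y in Metric.closedBall x ((1 / 2) ^ n), u y ∂μ
  -- At scale `r` the squared difference of averages is of order `r ^ s / (r ^ α * r ^ α)`, whence
  -- the exponent `s / 2 - α`, positive because `s > 2α`.
  set γ : ℝ := s / 2 - α
  have hγ : 0 < γ := by simp only [γ]; linarith
  set q : ℝ := (1 / 2) ^ γ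
  have hq0 : 0 ≤ q := by positivity
  have hq1 : q < 1 := Real.rpow_lt_one (by norm_num) (by norm_num) hγ
  set M : ℝ := √(3 ^ s * E / (c * (c * (1 / 2) ^ α)))
  have hpow : ∀ (n : ℕ) (t : ℝ), ((1 / 2 : ℝ) ^ n) ^ t = ((1 / 2 : ℝ) ^ t) ^ n := fun n t => by
    rw [← Real.rpow_natCast, ← Real.rpow_mul (by norm_num), mul_comm, Real.rpow_mul (by norm_num),
      Real.rpow_natCast]
  -- One estimate with two uses: `x = y`, `m = n + 1` gives convergence of the averages, and `m = n`
  -- for nearby points gives continuity of the limit. In `M`, the 3 is radius plus distance plus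
  -- radius, and the extra `(1/2) ^ α` allows for the ball one scale smaller.
  have key : ∀ x y n m, n ≤ m → m ≤ n + 1 → dist x y ≤ (1 / 2) ^ n →
      dist (A x n) (A y m) ≤ M * q ^ n := by
    intro x y n m hnm hmn hxy
    have hr0 : (0 : ℝ) < (1 / 2) ^ n := by positivity
    have hr1 : (1 / 2 : ℝ) ^ n ≤ 1 := pow_le_one₀ (by norm_num) (by norm_num)
    have hm1 : (1 / 2 : ℝ) ^ m ≤ 1 := pow_le_one₀ (by norm_num) (by norm_num)
    have hmle : (1 / 2 : ℝ) ^ m ≤ (1 / 2) ^ n :=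
      pow_le_pow_of_le_one (by norm_num) (by norm_num) hnm
    have hmge : (1 / 2 : ℝ) ^ n * (1 / 2) ≤ (1 / 2) ^ m := by
      rw [← pow_succ]; exact pow_le_pow_of_le_one (by norm_num) (by norm_num) hmn
    have h1 := sq_setAverage_sub_setAverage_le hs0 hui
      (Metric.isClosed_closedBall (x := x) (ε := (1 / 2) ^ n)).measurableSet
      (Metric.isClosed_closedBall (x := y) (ε := (1 / 2) ^ m)).measurableSet
      (hpos x _ hr0 hr1) (hpos y _ (by positivity) hm1) (d := 3 * (1 / 2) ^ n)
      (fun x' hx' y' hy' => by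
        have := dist_triangle4 x' x y y'
        have h2 := Metric.mem_closedBall.1 hx'
        have h3 := Metric.mem_closedBall'.1 hy'
        linarith) hE
    have h4 : (A x n - A y m) ^ 2 ≤ (M * q ^ n) ^ 2 := by
      refine h1.trans ?_
      have h5 : c * ((1 / 2 : ℝ) ^ n) ^ α * (c * ((1 / 2) ^ n * (1 / 2)) ^ α) ≤
          μ.real (Metric.closedBall x ((1 / 2) ^ n)) *
            μ.real (Metric.closedBall y ((1 / 2) ^ m)) := by
        refine mul_le_mul (hball x _ hr0 hr1) (le_trans ?_ (hball y _ (by positivity) hm1))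
          (by positivity) measureReal_nonneg
        gcongr
      refine (div_le_div_of_nonneg_left (by positivity) (by positivity) h5).trans (le_of_eq ?_)
      rw [mul_pow, Real.sq_sqrt (by positivity), Real.mul_rpow (by norm_num) hr0.le,
        Real.mul_rpow hr0.le (by norm_num), ← pow_mul, mul_comm n 2, pow_mul]
      have h6 : (q ^ 2) ^ n * (((1 / 2 : ℝ) ^ n) ^ α * ((1 / 2 : ℝ) ^ n) ^ α) =
          ((1 / 2 : ℝ) ^ n) ^ s := by
        rw [← pow_mul, mul_comm 2 n, pow_mul,
          show q ^ n = ((1 / 2 : ℝ) ^ n) ^ γ from (hpow n γ).symm,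
          sq, ← Real.rpow_add hr0, ← Real.rpow_add hr0, ← Real.rpow_add hr0]
        congr 1
        simp only [γ]; ring
      rw [← hEdef, ← h6]
      field_simp
    rw [Real.dist_eq]
    exact abs_le_of_sq_le_sq h4 (by positivity)
  have hcau : ∀ x n, dist (A x n) (A x (n + 1)) ≤ M * q ^ n := fun x n =>
    key x x n (n + 1) n.le_succ le_rfl (by rw [dist_self]; positivity)
  have hlim : ∀ x, ∃ l, Tendsto (A x) atTop (𝓝 l) := fun x =>
    cauchySeq_tendsto_of_complete (cauchySeq_of_le_geometric q M hq1 (hcau x))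
  choose g hg using hlim
  have hgA : ∀ x n, dist (A x n) (g x) ≤ M * q ^ n / (1 - q) := fun x n =>
    dist_le_of_le_geometric_of_tendsto q M hq1 (hcau x) (hg x) n
  have hqn : Tendsto (fun n : ℕ => q ^ n) atTop (𝓝 0) :=
    tendsto_pow_atTop_nhds_zero_of_lt_one hq0 hq1
  refine ⟨g, ?_, ?_⟩
  · rw [Metric.continuous_iff]
    intro x ε hε
    have ht : Tendsto (fun n : ℕ => (M + 2 * M / (1 - q)) * q ^ n) atTop (𝓝 0) := by
      simpa using hqn.const_mul (M + 2 * M / (1 - q))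
    obtain ⟨n, hn⟩ := (ht.eventually (gt_mem_nhds hε)).exists
    refine ⟨(1 / 2) ^ n, by positivity, fun y hy => ?_⟩
    calc dist (g y) (g x) ≤ dist (g y) (A y n) + dist (A y n) (A x n) + dist (A x n) (g x) :=
          dist_triangle4 _ _ _ _
      _ ≤ M * q ^ n / (1 - q) + M * q ^ n + M * q ^ n / (1 - q) := by
          refine add_le_add (add_le_add ?_ (key y x n n le_rfl n.le_succ hy.le)) (hgA x n)
          rw [dist_comm]; exact hgA y n
      _ = (M + 2 * M / (1 - q)) * q ^ n := by ring
      _ < ε := hn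
  -- By Fubini the inner energy at `x` is finite for almost every `x`; there the averages also tend
  -- to `u x`, with squared error of order `2 ^ (-(s - α) n)`.
  · filter_upwards [hE.prod_right_ae] with x hx
    refine tendsto_nhds_unique ?_ (hg x)
    set G := ∫ y, jumpDensity s u u (x, y) ∂μ with hG
    have hG0 : 0 ≤ G := integral_nonneg fun y => jumpDensity_self_nonneg s u _
    have ht : Tendsto (fun n : ℕ => G / c * ((1 / 2 : ℝ) ^ (s - α)) ^ n) atTop (𝓝 0) := by
      simpa using (tendsto_pow_atTop_nhds_zero_of_lt_one (by positivity)
        (Real.rpow_lt_one (by norm_num) (by norm_num) (by linarith) :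
          (1 / 2 : ℝ) ^ (s - α) < 1)).const_mul (G / c)
    have hsq : Tendsto (fun n => (u x - A x n) ^ 2) atTop (𝓝 0) := by
      refine squeeze_zero (fun n => sq_nonneg _) (fun n => ?_) ht
      have hr0 : (0 : ℝ) < (1 / 2) ^ n := by positivity
      have hr1 : (1 / 2 : ℝ) ^ n ≤ 1 := pow_le_one₀ (by norm_num) (by norm_num)
      refine (sq_sub_setAverage_le hs0 hui Metric.isClosed_closedBall.measurableSet
        (hpos x _ hr0 hr1) (d := (1 / 2) ^ n) (fun y hy => Metric.mem_closedBall'.1 hy) hx).trans ?_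
      refine (div_le_div_of_nonneg_left (by positivity) (by positivity)
        (hball x _ hr0 hr1)).trans (le_of_eq ?_)
      rw [← hpow, Real.rpow_sub hr0, ← hG]
      field_simp
    have habs : Tendsto (fun n => |u x - A x n|) atTop (𝓝 0) := by
      have := (Real.continuous_sqrt.tendsto 0).comp hsq
      simpa [Function.comp_def, Real.sqrt_sq_eq_abs] using this
    rw [tendsto_iff_dist_tendsto_zero]
    simpa [Real.dist_eq, abs_sub_comm] using habs

end Embedding

/-! ### Harmonic functions on the gasket -/

/-- The values on the corners of the `i`-th cell of the harmonic function with boundary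
values `a`. -/
noncomputable def harmStep (i : Fin 3) (a : Fin 3 → ℝ) : Fin 3 → ℝ :=
  fun j => if j = i then a i else (a i + a j + (a 0 + a 1 + a 2)) / 5

/-- Iteration of `harmStep` along a word. -/
noncomputable def wordStep : {n : ℕ} → (Fin n → Fin 3) → (Fin 3 → ℝ) → Fin 3 → ℝ
  | 0, _, a => a
  | _ + 1, w, a => wordStep (Fin.tail w) (harmStep (w 0) a)

/-- Maximum principle: new values are convex combinations with weights `2/5, 2/5, 1/5`. -/
lemma harmStep_mem_Icc {a : Fin 3 → ℝ} {l h : ℝ} (ha : ∀ i, a i ∈ Icc l h) (i j : Fin 3) :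
    harmStep i a j ∈ Icc l h := by
  have h0 := ha 0
  have h1 := ha 1
  have h2 := ha 2
  have hi := ha i
  have hj := ha j
  simp only [mem_Icc, harmStep] at *
  split_ifs
  · exact hi
  · constructor <;> linarith

lemma abs_harmStep_sub_le {a : Fin 3 → ℝ} {W : ℝ} (ha : ∀ i j, |a i - a j| ≤ W) (i j k : Fin 3) :
    |harmStep i a j - harmStep i a k| ≤ 3 / 5 * W := by
  have hW : 0 ≤ W := (abs_nonneg _).trans (ha 0 0)
  have h01 := abs_le.1 (ha 0 1)
  have h02 := abs_le.1 (ha 0 2)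
  have h12 := abs_le.1 (ha 1 2)
  rw [abs_le]
  fin_cases i <;> fin_cases j <;> fin_cases k <;> simp [harmStep] <;> (try constructor) <;> linarith

lemma abs_wordStep_sub_le {n : ℕ} (w : Fin n → Fin 3) {a : Fin 3 → ℝ} {W : ℝ}
    (ha : ∀ i j, |a i - a j| ≤ W) (j k : Fin 3) :
    |wordStep w a j - wordStep w a k| ≤ (3 / 5) ^ n * W := by
  induction n generalizing a W with
  | zero => simpa [wordStep] using ha j k
  | succ n ih =>
    rw [wordStep, pow_succ, mul_assoc]
    exact ih _ (abs_harmStep_sub_le ha _)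

/-- The graph energy of the boundary values. -/
def graphEnergy (a : Fin 3 → ℝ) : ℝ := (a 0 - a 1) ^ 2 + (a 1 - a 2) ^ 2 + (a 2 - a 0) ^ 2

lemma graphEnergy_nonneg (a : Fin 3 → ℝ) : 0 ≤ graphEnergy a := by
  unfold graphEnergy; positivity

lemma abs_sub_le_sqrt_graphEnergy (a : Fin 3 → ℝ) (i j : Fin 3) :
    |a i - a j| ≤ √(graphEnergy a) := by
  refine Real.abs_le_sqrt ?_
  unfold graphEnergy
  fin_cases i <;> fin_cases j <;> simp <;>
    nlinarith [sq_nonneg (a 0 - a 1), sq_nonneg (a 1 - a 2), sq_nonneg (a 2 - a 0)]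

/-- The renormalization factor `3/5` of the gasket; it is the source of the 5 in `β*`. -/
lemma sum_graphEnergy_harmStep (a : Fin 3 → ℝ) :
    ∑ i, graphEnergy (harmStep i a) = 3 / 5 * graphEnergy a := by
  simp only [Fin.sum_univ_three, graphEnergy, harmStep]
  simp
  ring

lemma sum_graphEnergy_wordStep (n : ℕ) (a : Fin 3 → ℝ) :
    ∑ w : Fin n → Fin 3, graphEnergy (wordStep w a) = (3 / 5) ^ n * graphEnergy a := by
  induction n generalizing a with
  | zero => simp [wordStep]
  | succ n ih =>
    rw [← (Fin.consEquiv fun _ => Fin 3).sum_comp, Fintype.sum_prod_type]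
    have e : ∀ (i : Fin 3) (w : Fin n → Fin 3),
        wordStep (Fin.consEquiv (fun _ => Fin 3) (i, w)) a = wordStep w (harmStep i a) :=
      fun _ _ => rfl
    simp only [e, ih]
    rw [← Finset.mul_sum, sum_graphEnergy_harmStep]
    ring

/-- A first letter of an address of `x`. -/
noncomputable def firstLetter (x : sierpinskiGasket) : Fin 3 := (exists_gmap_eq x).choose

/-- The preimage of `x` under `f_i`, with `i` the chosen first letter. -/
noncomputable def shiftPt (x : sierpinskiGasket) : sierpinskiGasket :=
  (exists_gmap_eq x).choose_spec.choose

lemma gmap_firstLetter_shiftPt (x : sierpinskiGasket) : gmap (firstLetter x) (shiftPt x) = x :=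
  (exists_gmap_eq x).choose_spec.choose_spec

/-- The boundary values on the `n`-cell of `x` along the chosen address. -/
noncomputable def cellValues : ℕ → (Fin 3 → ℝ) → sierpinskiGasket → Fin 3 → ℝ
  | 0, a, _ => a
  | n + 1, a, x => cellValues n (harmStep (firstLetter x) a) (shiftPt x)

lemma cellValues_mem_Icc (n : ℕ) {a : Fin 3 → ℝ} {l h : ℝ} (ha : ∀ i, a i ∈ Icc l h)
    (x : sierpinskiGasket) (i : Fin 3) : cellValues n a x i ∈ Icc l h := by
  induction n generalizing a x with
  | zero => exact ha i
  | succ n ih => exact ih (harmStep_mem_Icc ha _) _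

lemma dist_cellValues_succ_le (n : ℕ) {a : Fin 3 → ℝ} {W : ℝ} (ha : ∀ i j, |a i - a j| ≤ W)
    (x : sierpinskiGasket) :
    dist (cellValues n a x 0) (cellValues (n + 1) a x 0) ≤ W * (3 / 5) ^ n := by
  induction n generalizing a x W with
  | zero =>
    have h0 := abs_le.1 (ha 0 1)
    have h1 := abs_le.1 (ha 0 2)
    have hi := abs_le.1 (ha 0 (firstLetter x))
    simp only [cellValues, Real.dist_eq, pow_zero, mul_one, harmStep, abs_le]
    split_ifs with h
    · constructor <;> linarith
    · constructor <;> linarith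
  | succ n ih =>
    refine (ih (abs_harmStep_sub_le ha (firstLetter x)) (shiftPt x)).trans (le_of_eq ?_)
    ring

lemma exists_tendsto_cellValues (a : Fin 3 → ℝ) (x : sierpinskiGasket) :
    ∃ l, Tendsto (fun n => cellValues n a x 0) atTop (𝓝 l) :=
  cauchySeq_tendsto_of_complete (cauchySeq_of_le_geometric (3 / 5) _ (by norm_num) fun n =>
    dist_cellValues_succ_le n (abs_sub_le_sqrt_graphEnergy a) x)

/-- The harmonic function on the gasket with boundary values `a`. -/
noncomputable def harmonicFun (a : Fin 3 → ℝ) (x : sierpinskiGasket) : ℝ :=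
  (exists_tendsto_cellValues a x).choose

lemma tendsto_harmonicFun (a : Fin 3 → ℝ) (x : sierpinskiGasket) :
    Tendsto (fun n => cellValues n a x 0) atTop (𝓝 (harmonicFun a x)) :=
  (exists_tendsto_cellValues a x).choose_spec

lemma harmonicFun_eq_shiftPt (a : Fin 3 → ℝ) (x : sierpinskiGasket) :
    harmonicFun a x = harmonicFun (harmStep (firstLetter x) a) (shiftPt x) :=
  tendsto_nhds_unique ((tendsto_add_atTop_iff_nat 1).2 (tendsto_harmonicFun a x))
    (tendsto_harmonicFun (harmStep (firstLetter x) a) (shiftPt x))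

lemma harmonicFun_mem_Icc {a : Fin 3 → ℝ} {l h : ℝ} (ha : ∀ i, a i ∈ Icc l h)
    (x : sierpinskiGasket) : harmonicFun a x ∈ Icc l h :=
  isClosed_Icc.mem_of_tendsto (tendsto_harmonicFun a x)
    (Eventually.of_forall fun n => cellValues_mem_Icc n ha x 0)

lemma abs_harmonicFun_sub_le {a : Fin 3 → ℝ} {W : ℝ} (ha : ∀ i j, |a i - a j| ≤ W)
    (x y : sierpinskiGasket) : |harmonicFun a x - harmonicFun a y| ≤ W := by
  obtain ⟨i, hi⟩ := Finite.exists_min a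
  obtain ⟨j, hj⟩ := Finite.exists_max a
  have hx := harmonicFun_mem_Icc (fun k => ⟨hi k, hj k⟩) x
  have hy := harmonicFun_mem_Icc (fun k => ⟨hi k, hj k⟩) y
  have := abs_le.1 (ha j i)
  rw [mem_Icc] at hx hy
  rw [abs_le]
  constructor <;> linarith

lemma bary_cornerPt_self (i : Fin 3) : bary i (cornerPt i) = 1 := by
  simp [cornerPt, bary_corner]

lemma eq_of_gmap_eq_cornerPt {k i : Fin 3} {y : sierpinskiGasket} (h : gmap k y = cornerPt i) :
    k = i ∧ y = cornerPt i := by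
  have hk : k = i := by
    by_contra hk
    have h1 := bary_gmap k i y
    have h2 := bary_le_one y i
    rw [h, if_neg hk, bary_cornerPt_self] at h1
    linarith
  subst hk
  exact ⟨rfl, gmap_injective k (h.trans (gmap_cornerPt k).symm)⟩

/-- The address of a corner is forced to be constant. Along it the value `a i` is kept while the
oscillation shrinks by `3/5` at each step. -/
lemma harmonicFun_cornerPt (a : Fin 3 → ℝ) (i : Fin 3) : harmonicFun a (cornerPt i) = a i := by
  obtain ⟨h1, h2⟩ := eq_of_gmap_eq_cornerPt (gmap_firstLetter_shiftPt (cornerPt i))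
  have key : ∀ (n : ℕ) (a : Fin 3 → ℝ) (W : ℝ), (∀ i j, |a i - a j| ≤ W) →
      |harmonicFun a (cornerPt i) - a i| ≤ W * (3 / 5) ^ n := by
    intro n
    induction n with
    | zero =>
      intro a W ha
      have hW := harmonicFun_mem_Icc (a := a) (l := a i - W) (h := a i + W) (fun k => by
        have := abs_le.1 (ha i k)
        constructor <;> linarith) (cornerPt i)
      rw [abs_le, pow_zero]
      constructor <;> linarith [hW.1, hW.2]
    | succ n ih =>
      intro a W ha
      have := ih (harmStep i a) _ (abs_harmStep_sub_le ha i)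
      have e : harmonicFun a (cornerPt i) = harmonicFun (harmStep i a) (cornerPt i) := by
        rw [harmonicFun_eq_shiftPt, h1, h2]
      have e2 : harmStep i a i = a i := if_pos rfl
      rw [e2, ← e] at this
      refine this.trans (le_of_eq ?_)
      ring
  have ht : Tendsto (fun n : ℕ => √(graphEnergy a) * (3 / 5 : ℝ) ^ n) atTop (𝓝 0) := by
    simpa using (tendsto_pow_atTop_nhds_zero_of_lt_one (by norm_num)
      (by norm_num : (3 / 5 : ℝ) < 1)).const_mul (√(graphEnergy a))
  have := ge_of_tendsto' ht fun n => key n a _ (abs_sub_le_sqrt_graphEnergy a)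
  exact sub_eq_zero.1 (abs_nonpos_iff.1 this)

lemma harmStep_comm (i j : Fin 3) (a : Fin 3 → ℝ) : harmStep i a j = harmStep j a i := by
  simp only [harmStep]
  rcases eq_or_ne i j with rfl | h
  · rfl
  · rw [if_neg h, if_neg h.symm, add_comm (a i)]

/-- Independence of the chosen address: if the chosen first letter is not `i`, the point is a
junction, where the two cells prescribe the same value by `harmStep_comm`. -/
lemma harmonicFun_gmap (a : Fin 3 → ℝ) (i : Fin 3) (x : sierpinskiGasket) :
    harmonicFun a (gmap i x) = harmonicFun (harmStep i a) x := by
  rw [harmonicFun_eq_shiftPt]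
  have h := gmap_firstLetter_shiftPt (gmap i x)
  generalize firstLetter (gmap i x) = k, shiftPt (gmap i x) = y at h
  rcases eq_or_ne k i with rfl | h1
  · rw [gmap_injective k h]
  · obtain ⟨rfl, rfl⟩ := gmap_eq_gmap h1 h
    rw [harmonicFun_cornerPt, harmonicFun_cornerPt, harmStep_comm]

lemma harmonicFun_cellMap {n : ℕ} (w : Fin n → Fin 3) (a : Fin 3 → ℝ) (x : sierpinskiGasket) :
    harmonicFun a (cellMap w x) = harmonicFun (wordStep w a) x := by
  induction n generalizing a with
  | zero => rfl
  | succ n ih => rw [cellMap, harmonicFun_gmap, ih, wordStep]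

lemma harmonicFun_continuous (a : Fin 3 → ℝ) : Continuous (harmonicFun a) := by
  rw [continuous_iff_continuousAt]
  intro x
  rw [ContinuousAt, Metric.tendsto_nhds]
  intro ε hε
  have ht : Tendsto (fun n : ℕ => (3 / 5 : ℝ) ^ n * √(graphEnergy a)) atTop (𝓝 0) := by
    simpa using (tendsto_pow_atTop_nhds_zero_of_lt_one (by norm_num)
      (by norm_num : (3 / 5 : ℝ) < 1)).mul_const (√(graphEnergy a))
  obtain ⟨n, hn⟩ := (ht.eventually (gt_mem_nhds hε)).exists
  -- Removing the finitely many `n`-cells that miss `x` leaves a neighbourhood of `x`, each point of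
  -- which shares an `n`-cell with `x`.
  have hcl : IsClosed (⋃ w : {w : Fin n → Fin 3 // x ∉ range (cellMap w)},
      range (cellMap w.1)) := isClosed_iUnion_of_finite fun w => range_cellMap_isClosed _
  have hx : x ∈ (⋃ w : {w : Fin n → Fin 3 // x ∉ range (cellMap w)}, range (cellMap w.1))ᶜ := by
    intro hx
    obtain ⟨w, hw⟩ := mem_iUnion.1 hx
    exact w.2 hw
  filter_upwards [hcl.isOpen_compl.mem_nhds hx] with y hy
  obtain ⟨w, z, rfl⟩ := exists_cellMap_eq n y
  have hxw : x ∈ range (cellMap w) := by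
    by_contra h
    exact hy (mem_iUnion.2 ⟨⟨w, h⟩, mem_range_self z⟩)
  obtain ⟨z', rfl⟩ := hxw
  rw [Real.dist_eq, harmonicFun_cellMap, harmonicFun_cellMap]
  exact (abs_harmonicFun_sub_le
    (abs_wordStep_sub_le w (abs_sub_le_sqrt_graphEnergy a)) _ _).trans_lt hn

/-! ### Harmonic functions separate points -/

lemma harmStep_surjective (i : Fin 3) : Function.Surjective (harmStep i) := by
  have key : ∀ j k : Fin 3, i ≠ j → i ≠ k → j ≠ k → ∀ b : Fin 3 → ℝ, ∃ a, harmStep i a = b := by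
    intro j k hij hik hjk b
    -- The witness is the explicit inverse of the `3 × 3` linear map.
    refine ⟨fun l => if l = i then b i else if l = j then (10 * b j - 5 * b k - 2 * b i) / 3
      else (10 * b k - 5 * b j - 2 * b i) / 3, ?_⟩
    ext l
    fin_cases i <;> fin_cases j <;> fin_cases k <;> first
      | (exfalso; first | exact hij rfl | exact hik rfl | exact hjk rfl)
      | (fin_cases l <;> simp [harmStep] <;> ring)
  fin_cases i
  · exact key 1 2 (by decide) (by decide) (by decide)
  · exact key 0 2 (by decide) (by decide) (by decide)
  · exact key 0 1 (by decide) (by decide) (by decide)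

/-- Strong maximum principle. On a cell `l ≠ j` all three corner values are positive, so a zero lies
in cell `j`; there the hypotheses on `b` recur, and the argument repeats at every scale. -/
lemma eq_cornerPt_of_harmonicFun_eq_zero {j : Fin 3} {b : Fin 3 → ℝ} (hj : b j = 0)
    (hb : ∀ i, i ≠ j → 0 < b i) {x : sierpinskiGasket} (hx : harmonicFun b x = 0) :
    x = cornerPt j := by
  have hnn : ∀ b : Fin 3 → ℝ, b j = 0 → (∀ i, i ≠ j → 0 < b i) → ∀ i l, l ≠ j →
      0 < harmStep l b i ∧ (i ≠ j → 0 < harmStep j b i) := by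
    intro b hj hb i l hl
    have hpos : ∀ k, 0 ≤ b k := fun k => by
      rcases eq_or_ne k j with rfl | h
      · exact hj.ge
      · exact (hb k h).le
    have h0 := hpos 0
    have h1 := hpos 1
    have h2 := hpos 2
    have hi := hpos i
    have hll := hb l hl
    constructor
    · simp only [harmStep]
      split_ifs <;> linarith
    · intro hij
      simp only [harmStep, if_neg hij]
      have := hb i hij
      linarith
  refine eq_of_forall_dist_le_pow fun n => ?_
  induction n generalizing b x with
  | zero => simpa using dist_le_two x (cornerPt j)
  | succ n ih =>
    obtain ⟨l, y, rfl⟩ := exists_gmap_eq x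
    rw [harmonicFun_gmap] at hx
    rcases eq_or_ne l j with rfl | hl
    · obtain ⟨k, hk⟩ := exists_ne l
      have := ih (b := harmStep l b) ((if_pos rfl).trans hj)
        (fun i hi => (hnn b hj hb i k hk).2 hi) hx
      rw [← gmap_cornerPt l, dist_gmap, pow_succ]
      linarith
    · exfalso
      obtain ⟨m, hm⟩ := Finite.exists_min (harmStep l b)
      obtain ⟨M, hM⟩ := Finite.exists_max (harmStep l b)
      have := (harmonicFun_mem_Icc (fun k => ⟨hm k, hM k⟩) y).1
      have h2 := (hnn b hj hb m l hl).1
      linarith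

lemma harmonicFun_separates {x y : sierpinskiGasket}
    (h : ∀ a, harmonicFun a x = harmonicFun a y) : x = y := by
  refine eq_of_forall_dist_le_pow fun n => ?_
  induction n generalizing x y with
  | zero => simpa using dist_le_two x y
  | succ n ih =>
    obtain ⟨i, x, rfl⟩ := exists_gmap_eq x
    obtain ⟨j, y, rfl⟩ := exists_gmap_eq y
    simp only [harmonicFun_gmap] at h
    rcases eq_or_ne i j with rfl | hij
    -- In a common cell, surjectivity of `harmStep i` makes every harmonic function on that cell a
    -- restriction, so the hypothesis descends.
    · have := ih (x := x) (y := y) fun b => by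
        obtain ⟨a, rfl⟩ := harmStep_surjective i b
        exact h a
      rw [dist_gmap, pow_succ]
      linarith
    -- In different cells, take boundary values 1 at `i`, -1 at `j`, 0 at the third corner. This
    -- function is nonnegative on cell `i`, vanishing there only at the junction, and nonpositive on
    -- cell `j`; equal values force the point of cell `i` to be the junction.
    · have key : ∀ i j : Fin 3, i ≠ j → ∀ x y : sierpinskiGasket,
          (∀ a, harmonicFun (harmStep i a) x = harmonicFun (harmStep j a) y) →
          x = cornerPt j := by
        intro i j hij x y h
        have hx := h (fun k => if k = i then 1 else if k = j then -1 else 0)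
        have h1 : harmStep i (fun k => if k = i then 1 else if k = j then -1 else 0) j = 0 := by
          fin_cases i <;> fin_cases j <;> simp [harmStep] at hij ⊢
        have h2 : ∀ k, k ≠ j →
            0 < harmStep i (fun k => if k = i then 1 else if k = j then -1 else 0) k := by
          intro k hk
          fin_cases i <;> fin_cases j <;> fin_cases k <;> simp [harmStep] at hij hk ⊢
        have h3 : ∀ k, harmStep j (fun k => if k = i then 1 else if k = j then -1 else 0) k ∈
            Icc (-1 : ℝ) 0 := by
          intro k
          rw [mem_Icc]
          fin_cases i <;> fin_cases j <;> fin_cases k <;> simp [harmStep] at hij ⊢ <;> norm_num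
        have h4 : ∀ k, harmStep i (fun k => if k = i then 1 else if k = j then -1 else 0) k ∈
            Icc (0 : ℝ) 1 := by
          intro k
          rw [mem_Icc]
          fin_cases i <;> fin_cases j <;> fin_cases k <;> simp [harmStep] at hij ⊢ <;> norm_num
        refine eq_cornerPt_of_harmonicFun_eq_zero h1 h2 (le_antisymm ?_ ?_)
        · rw [hx]; exact (harmonicFun_mem_Icc h3 y).2
        · exact (harmonicFun_mem_Icc h4 x).1
      rw [key i j hij x y h, key j i hij.symm y x fun a => (h a).symm, gmap_cornerPt_comm,
        dist_self]
      positivity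

/-! ### The energy of harmonic functions -/

lemma cellMap_const_cornerPt (j : Fin 3) (m : ℕ) :
    cellMap (fun _ : Fin m => j) (cornerPt j) = cornerPt j := by
  induction m with
  | zero => rfl
  | succ m ih =>
    change gmap j (cellMap (fun _ : Fin m => j) (cornerPt j)) = cornerPt j
    rw [ih, gmap_cornerPt]

lemma one_sub_bary_cellMap_const (j : Fin 3) (m : ℕ) (x : sierpinskiGasket) :
    1 - bary j (cellMap (fun _ : Fin m => j) x) = (1 / 2) ^ m * (1 - bary j x) := by
  induction m with
  | zero => simp [cellMap]
  | succ m ih =>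
    change 1 - bary j (gmap j (cellMap (fun _ : Fin m => j) x)) = _
    rw [bary_gmap, if_pos rfl, pow_succ]
    linarith

lemma bary_le_half_of_notMem_range {j : Fin 3} {x : sierpinskiGasket} (hx : x ∉ range (gmap j)) :
    bary j x ≤ 1 / 2 := by
  obtain ⟨k, y, rfl⟩ := exists_gmap_eq x
  have hk : k ≠ j := by
    rintro rfl
    exact hx (mem_range_self y)
  rw [bary_gmap, if_neg hk]
  linarith [bary_le_one y j]

/-- The `j`-th coordinate is at most `1/2 - 2 ^ (-(m + 2))` at the first point and at least `1/2` at
the second. The Lipschitz constant 2 of `abs_bary_sub_le` costs the last factor `1/2`. -/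
lemma le_dist_gmap_cellMap_const {i j : Fin 3} (hij : i ≠ j) (m : ℕ) {x : sierpinskiGasket}
    (y : sierpinskiGasket) (hx : x ∉ range (gmap j)) :
    (1 / 2) ^ (m + 3) ≤ dist (gmap i (cellMap (fun _ : Fin m => j) x)) (gmap j y) := by
  have h1 := one_sub_bary_cellMap_const j m x
  have h2 := bary_le_half_of_notMem_range hx
  have h3 := bary_gmap i j (cellMap (fun _ : Fin m => j) x)
  have h4 := bary_gmap j j y
  rw [if_neg hij] at h3
  rw [if_pos rfl] at h4
  have h5 := bary_nonneg y j
  have h6 := abs_bary_sub_le j (gmap i (cellMap (fun _ : Fin m => j) x)) (gmap j y)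
  rw [← Subtype.dist_eq, h3, h4] at h6
  have h7 := (abs_le.1 h6).1
  have h8 : (1 / 2 : ℝ) ^ m * (1 / 2) ≤ (1 / 2) ^ m * (1 - bary j x) := by
    gcongr; linarith
  rw [pow_add, show (1 / 2 : ℝ) ^ 3 = 1 / 8 by norm_num]
  linarith

/-- Otherwise the two points would share cells of every level. -/
lemma exists_splitting_cell {x y : sierpinskiGasket} (hxy : x ≠ y) :
    ∃ (n : ℕ) (w : Fin n → Fin 3) (i j : Fin 3) (x' y' : sierpinskiGasket), i ≠ j ∧
      x = cellMap w (gmap i x') ∧ y = cellMap w (gmap j y') := by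
  by_contra! hcon
  refine hxy (eq_of_forall_dist_le_pow fun n => ?_)
  have key : ∃ (w : Fin n → Fin 3) (x' y' : sierpinskiGasket),
      x = cellMap w x' ∧ y = cellMap w y' := by
    induction n with
    | zero => exact ⟨Fin.elim0, x, y, rfl, rfl⟩
    | succ n ih =>
      obtain ⟨w, x', y', hx, hy⟩ := ih
      obtain ⟨i, x', rfl⟩ := exists_gmap_eq x'
      obtain ⟨j, y', rfl⟩ := exists_gmap_eq y'
      obtain rfl : i = j := by
        by_contra hij
        exact hcon n w i j x' y' hij hx hy
      exact ⟨Fin.snoc w i, x', y', by rw [cellMap_snoc, hx], by rw [cellMap_snoc, hy]⟩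
  obtain ⟨w, x', y', rfl, rfl⟩ := key
  rw [dist_cellMap]
  have := dist_le_two x' y'
  gcongr

lemma eq_cornerPt_of_forall_mem_range {j : Fin 3} {x : sierpinskiGasket}
    (h : ∀ m : ℕ, x ∈ range (cellMap fun _ : Fin m => j)) : x = cornerPt j := by
  refine eq_of_forall_dist_le_pow fun m => ?_
  obtain ⟨z, rfl⟩ := h m
  rw [← cellMap_const_cornerPt j m, dist_cellMap]
  have := dist_le_two z (cornerPt j)
  gcongr

/-- Zoom in on the junction from both sides at the same rate until one point drops out. If neither
ever did, both images would be the junction itself. -/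
lemma exists_corner_scale {i j : Fin 3} {x y : sierpinskiGasket}
    (hxy : gmap i x ≠ gmap j y) : ∃ (m : ℕ) (x' y' : sierpinskiGasket),
      x = cellMap (fun _ : Fin m => j) x' ∧ y = cellMap (fun _ : Fin m => i) y' ∧
        (x' ∉ range (gmap j) ∨ y' ∉ range (gmap i)) := by
  by_contra! hcon
  have hsnoc : ∀ (k : Fin 3) (m : ℕ) (z : sierpinskiGasket),
      cellMap (fun _ : Fin m => k) (gmap k z) = cellMap (fun _ : Fin (m + 1) => k) z := by
    intro k m z
    rw [← cellMap_snoc]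
    congr 1
    ext l
    refine Fin.lastCases ?_ (fun l => ?_) l <;> simp
  have key : ∀ m : ℕ, ∃ x' y', x = cellMap (fun _ : Fin m => j) x' ∧
      y = cellMap (fun _ : Fin m => i) y' := by
    intro m
    induction m with
    | zero => exact ⟨x, y, rfl, rfl⟩
    | succ m ih =>
      obtain ⟨x', y', hx, hy⟩ := ih
      obtain ⟨⟨x', rfl⟩, ⟨y', rfl⟩⟩ := hcon m x' y' hx hy
      exact ⟨x', y', by rw [hx, hsnoc], by rw [hy, hsnoc]⟩
  have hx : x = cornerPt j := eq_cornerPt_of_forall_mem_range fun m => by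
    obtain ⟨x', y', h, -⟩ := key m; exact ⟨x', h.symm⟩
  have hy : y = cornerPt i := eq_cornerPt_of_forall_mem_range fun m => by
    obtain ⟨x', y', -, h⟩ := key m; exact ⟨y', h.symm⟩
  exact hxy (by rw [hx, hy, gmap_cornerPt_comm])

/-- The map onto the cell with address `w i j^m`. -/
noncomputable def junctionMap {n : ℕ} (w : Fin n → Fin 3) (m : ℕ) (i j : Fin 3)
    (x : sierpinskiGasket) : sierpinskiGasket :=
  cellMap w (gmap i (cellMap (fun _ : Fin m => j) x))

lemma dist_junctionMap {n : ℕ} (w : Fin n → Fin 3) (m : ℕ) (i j : Fin 3)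
    (x y : sierpinskiGasket) :
    dist (junctionMap w m i j x) (junctionMap w m i j y) = dist x y * (1 / 2) ^ (n + m + 1) := by
  simp only [junctionMap, dist_cellMap, dist_gmap]
  ring

/-- The pairs of points on both sides of the junction of two subcells of a cell, at distance
comparable to `2^-(n+m)`. -/
def junctionSet {n : ℕ} (w : Fin n → Fin 3) (m : ℕ) (i j : Fin 3) :
    Set (sierpinskiGasket × sierpinskiGasket) :=
  (range (junctionMap w m i j) ×ˢ range (junctionMap w m j i)) ∩
    {p | (1 / 2) ^ (n + m + 3) ≤ dist p.1 p.2}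

lemma junctionSet_measurable {n : ℕ} (w : Fin n → Fin 3) (m : ℕ) (i j : Fin 3) :
    MeasurableSet (junctionSet w m i j) := by
  have hc : ∀ i j, IsClosed (range (junctionMap w m i j)) := fun i j =>
    (isCompact_range ((cellMap_continuous w).comp ((gmap_continuous i).comp
      (cellMap_continuous _)))).isClosed
  exact (((hc i j).prod (hc j i)).inter
    (isClosed_le continuous_const continuous_dist)).measurableSet

lemma measure_junctionSet_le {n : ℕ} (w : Fin n → Fin 3) (m : ℕ) (i j : Fin 3) :
    (gasketMeasure.prod gasketMeasure) (junctionSet w m i j) ≤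
      ENNReal.ofReal ((1 / 9) ^ (n + m)) := by
  refine (measure_mono inter_subset_left).trans ?_
  rw [Measure.prod_prod, gasketMeasure_range_of_dist (dist_junctionMap w m i j),
    gasketMeasure_range_of_dist (dist_junctionMap w m j i), ← mul_pow]
  have e : (3⁻¹ * 3⁻¹ : ℝ≥0∞) = ENNReal.ofReal (1 / 9) := by
    rw [← ENNReal.mul_inv (by norm_num) (by norm_num), one_div,
      ENNReal.ofReal_inv_of_pos (by norm_num), ENNReal.ofReal_ofNat]
    norm_num
  rw [e, ← ENNReal.ofReal_pow (by norm_num)]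
  exact ENNReal.ofReal_le_ofReal
    (pow_le_pow_of_le_one (by norm_num) (by norm_num) (Nat.le_succ _))

lemma exists_mem_junctionSet {p : sierpinskiGasket × sierpinskiGasket} (hp : p.1 ≠ p.2) :
    ∃ (n m : ℕ) (w : Fin n → Fin 3) (e : {e : Fin 3 × Fin 3 // e.1 ≠ e.2}),
      p ∈ junctionSet w m e.1.1 e.1.2 := by
  obtain ⟨n, w, i, j, x, y, hij, hx, hy⟩ := exists_splitting_cell hp
  obtain ⟨m, x', y', rfl, rfl, hor⟩ := exists_corner_scale (i := i) (j := j) (x := x) (y := y)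
    (fun h => hp (by rw [hx, hy, h]))
  refine ⟨n, m, w, ⟨(i, j), hij⟩, ⟨⟨x', hx.symm⟩, ⟨y', hy.symm⟩⟩, ?_⟩
  rw [mem_ofPred_eq, hx, hy, dist_cellMap, show n + m + 3 = m + 3 + n by ring, pow_add _ (m + 3)]
  gcongr
  rcases hor with h | h
  · exact le_dist_gmap_cellMap_const hij m _ h
  · rw [dist_comm]
    exact le_dist_gmap_cellMap_const hij.symm m _ h

/-- Compare both values with the one at the common junction. On each side the oscillation is at most
`(3/5) ^ m` times the root of the graph energy on cell `w`. -/
lemma sq_harmonicFun_sub_le {n : ℕ} (w : Fin n → Fin 3) (m : ℕ) (i j : Fin 3) (a : Fin 3 → ℝ)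
    (x y : sierpinskiGasket) :
    (harmonicFun a (junctionMap w m i j x) - harmonicFun a (junctionMap w m j i y)) ^ 2 ≤
      4 * ((9 / 25) ^ m * graphEnergy (wordStep w a)) := by
  set b := wordStep w a
  have hb := abs_sub_le_sqrt_graphEnergy b
  have h1 : ∀ i j x, |harmonicFun a (junctionMap w m i j x) -
      harmonicFun a (cellMap w (gmap i (cornerPt j)))| ≤ (3 / 5) ^ m * √(graphEnergy b) := by
    intro i j x
    rw [← cellMap_const_cornerPt j m, junctionMap]
    simp only [harmonicFun_cellMap, harmonicFun_gmap]
    refine (abs_harmonicFun_sub_le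
      (abs_wordStep_sub_le _ (abs_harmStep_sub_le hb i)) _ _).trans ?_
    gcongr
    linarith [Real.sqrt_nonneg (graphEnergy b)]
  have h2 := h1 i j x
  have h3 := h1 j i y
  rw [gmap_cornerPt_comm] at h3
  rw [abs_le] at h2 h3
  have h4 : |harmonicFun a (junctionMap w m i j x) - harmonicFun a (junctionMap w m j i y)| ≤
      2 * ((3 / 5) ^ m * √(graphEnergy b)) := by
    rw [abs_le]; constructor <;> linarith
  calc _ ≤ (2 * ((3 / 5) ^ m * √(graphEnergy b))) ^ 2 := sq_le_sq.2 (h4.trans (le_abs_self _))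
    _ = _ := by
      rw [mul_pow, mul_pow, Real.sq_sqrt (graphEnergy_nonneg b), ← pow_mul, mul_comm m 2, pow_mul]
      norm_num

/-- Supremum times measure: the squared difference contributes `(9/25) ^ m`, the kernel `2 ^ (s (n +
m + 3))`, the measure `9 ^ (-(n + m))`. -/
lemma setLIntegral_junctionSet_le {s : ℝ} (hs : 0 ≤ s) {n : ℕ} (w : Fin n → Fin 3) (m : ℕ)
    (i j : Fin 3) (a : Fin 3 → ℝ) :
    ∫⁻ p in junctionSet w m i j, ENNReal.ofReal
        ((harmonicFun a p.1 - harmonicFun a p.2) ^ 2 / dist p.1 p.2 ^ s)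
        ∂(gasketMeasure.prod gasketMeasure) ≤
      ENNReal.ofReal (4 * (2 ^ s) ^ 3 * (2 ^ s / 9) ^ n * ((2 ^ s / 25) ^ m) *
        graphEnergy (wordStep w a)) := by
  have hg := graphEnergy_nonneg (wordStep w a)
  have hb : ∀ p ∈ junctionSet w m i j,
      (harmonicFun a p.1 - harmonicFun a p.2) ^ 2 / dist p.1 p.2 ^ s ≤
        4 * ((9 / 25) ^ m * graphEnergy (wordStep w a)) * (2 ^ s) ^ (n + m + 3) := by
    rintro ⟨_, _⟩ ⟨⟨⟨x, rfl⟩, ⟨y, rfl⟩⟩, hd⟩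
    rw [mem_ofPred_eq] at hd
    have h1 := sq_harmonicFun_sub_le w m i j a x y
    have h2 : (0 : ℝ) < ((1 / 2) ^ (n + m + 3)) ^ s := by positivity
    have h3 : ((1 / 2 : ℝ) ^ (n + m + 3)) ^ s ≤
        dist (junctionMap w m i j x) (junctionMap w m j i y) ^ s :=
      Real.rpow_le_rpow (by positivity) hd hs
    refine (div_le_div₀ (by positivity) h1 h2 h3).trans (le_of_eq ?_)
    rw [div_eq_mul_inv]
    congr 1
    rw [← Real.rpow_natCast, ← Real.rpow_natCast, ← Real.rpow_mul (by norm_num),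
      ← Real.rpow_mul (by norm_num), ← Real.rpow_neg (by norm_num), one_div,
      Real.inv_rpow (by norm_num), Real.rpow_neg (by norm_num), inv_inv, mul_comm]
  calc _ ≤ ∫⁻ _ in junctionSet w m i j, ENNReal.ofReal (4 * ((9 / 25) ^ m *
          graphEnergy (wordStep w a)) * (2 ^ s) ^ (n + m + 3))
          ∂(gasketMeasure.prod gasketMeasure) :=
        setLIntegral_mono' (junctionSet_measurable w m i j) fun p hp =>
          ENNReal.ofReal_le_ofReal (hb p hp)
    _ ≤ ENNReal.ofReal (4 * ((9 / 25) ^ m * graphEnergy (wordStep w a)) *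
          (2 ^ s) ^ (n + m + 3)) * ENNReal.ofReal ((1 / 9) ^ (n + m)) := by
        rw [setLIntegral_const]
        gcongr
        exact measure_junctionSet_le w m i j
    _ = _ := by
        rw [← ENNReal.ofReal_mul (by positivity)]
        congr 1
        rw [show (2 ^ s / 25 : ℝ) = 9 / 25 * 2 ^ s * (1 / 9) by ring,
          show (2 ^ s / 9 : ℝ) = 2 ^ s * (1 / 9) by ring, mul_pow, mul_pow, mul_pow]
        ring

lemma tsum_ofReal_mul_pow_lt_top {C r : ℝ} (hC : 0 ≤ C) (hr0 : 0 ≤ r) (hr1 : r < 1) :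
    ∑' n : ℕ, ENNReal.ofReal (C * r ^ n) < ∞ := by
  have h : Summable fun n : ℕ => C * r ^ n := (summable_geometric_of_lt_one hr0 hr1).mul_left C
  rw [← ENNReal.ofReal_tsum_of_nonneg (fun n => by positivity) h]
  exact ENNReal.ofReal_lt_top

/-- Harmonic functions have finite energy for every exponent `s < α + β*`, that is `2^s < 15`. -/
theorem jumpEnergy_harmonicFun_lt_top {s : ℝ} (hs : 0 ≤ s) (hs2 : (2 : ℝ) ^ s < 15)
    (a : Fin 3 → ℝ) : jumpEnergy gasketMeasure s (harmonicFun a) < ∞ := by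
  set f : sierpinskiGasket × sierpinskiGasket → ℝ≥0∞ := fun p =>
    ENNReal.ofReal ((harmonicFun a p.1 - harmonicFun a p.2) ^ 2 / dist p.1 p.2 ^ s)
  set ρ := gasketMeasure.prod gasketMeasure
  set T : Set (sierpinskiGasket × sierpinskiGasket) :=
    ⋃ n : ℕ, ⋃ m : ℕ, ⋃ w : Fin n → Fin 3, ⋃ e : {e : Fin 3 × Fin 3 // e.1 ≠ e.2},
      junctionSet w m e.1.1 e.1.2
  have hTm : MeasurableSet T := MeasurableSet.iUnion fun n => MeasurableSet.iUnion fun m =>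
    MeasurableSet.iUnion fun w => MeasurableSet.iUnion fun e => junctionSet_measurable _ _ _ _
  -- The integrand vanishes on the diagonal, so covering its complement suffices.
  have hind : T.indicator f = f := by
    refine indicator_eq_self.2 fun p hp => ?_
    have hne : p.1 ≠ p.2 := by
      intro h
      exact hp (by simp [f, h])
    obtain ⟨n, m, w, e, h⟩ := exists_mem_junctionSet hne
    simp only [T, mem_iUnion]
    exact ⟨n, m, w, e, h⟩
  have hE : jumpEnergy gasketMeasure s (harmonicFun a) = ∫⁻ p in T, f p ∂ρ := by
    rw [← lintegral_indicator hTm, hind]; rfl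
  have hg := graphEnergy_nonneg a
  set N : ℝ := (Fintype.card {e : Fin 3 × Fin 3 // e.1 ≠ e.2} : ℝ)
  set C : ℝ := N * (4 * (2 ^ s) ^ 3) * graphEnergy a
  have hC : 0 ≤ C := by positivity
  rw [hE]
  calc ∫⁻ p in T, f p ∂ρ
      ≤ ∑' n : ℕ, ∑' m : ℕ, ∑' w : Fin n → Fin 3, ∑' e : {e : Fin 3 × Fin 3 // e.1 ≠ e.2},
          ∫⁻ p in junctionSet w m e.1.1 e.1.2, f p ∂ρ := by
        refine (lintegral_iUnion_le _ _).trans (ENNReal.tsum_le_tsum fun n => ?_)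
        refine (lintegral_iUnion_le _ _).trans (ENNReal.tsum_le_tsum fun m => ?_)
        refine (lintegral_iUnion_le _ _).trans (ENNReal.tsum_le_tsum fun w => ?_)
        exact lintegral_iUnion_le _ _
    _ ≤ ∑' n : ℕ, ∑' m : ℕ, ENNReal.ofReal (C * (2 ^ s / 15) ^ n) *
          ENNReal.ofReal (1 * (2 ^ s / 25) ^ m) := by
        refine ENNReal.tsum_le_tsum fun n => ENNReal.tsum_le_tsum fun m => ?_
        rw [tsum_fintype]
        calc _ ≤ ∑ w : Fin n → Fin 3, ENNReal.ofReal (N * (4 * (2 ^ s) ^ 3 * (2 ^ s / 9) ^ n *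
                ((2 ^ s / 25) ^ m) * graphEnergy (wordStep w a))) := by
              refine Finset.sum_le_sum fun w _ => ?_
              rw [tsum_fintype]
              refine (Finset.sum_le_sum fun e _ =>
                setLIntegral_junctionSet_le hs w m e.1.1 e.1.2 a).trans (le_of_eq ?_)
              rw [Finset.sum_const, Finset.card_univ, nsmul_eq_mul,
                ENNReal.ofReal_mul (Nat.cast_nonneg _), ENNReal.ofReal_natCast]
          _ = _ := by
              rw [← ENNReal.ofReal_sum_of_nonneg, ← ENNReal.ofReal_mul (by positivity)]
              · congr 1
                -- Summing graph energies over words brings in `(3/5) ^ n` and turns the ratio `2 ^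
                -- s / 9` into `2 ^ s / 15`: this is the critical threshold.
                rw [← Finset.mul_sum, ← Finset.mul_sum, sum_graphEnergy_wordStep,
                  show (2 ^ s / 15 : ℝ) = 2 ^ s / 9 * (3 / 5) by ring, mul_pow _ (3 / 5 : ℝ)]
                simp only [C]
                ring
              · intro w _
                have := graphEnergy_nonneg (wordStep w a)
                positivity
    _ = (∑' n : ℕ, ENNReal.ofReal (C * (2 ^ s / 15) ^ n)) *
          ∑' m : ℕ, ENNReal.ofReal (1 * (2 ^ s / 25) ^ m) := by
        simp only [ENNReal.tsum_mul_left, ENNReal.tsum_mul_right]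
    _ < ∞ := ENNReal.mul_lt_top
        (tsum_ofReal_mul_pow_lt_top hC (by positivity) (by linarith))
        (tsum_ofReal_mul_pow_lt_top zero_le_one (by positivity) (by linarith))

/-! ### The Dirichlet form -/

section JumpDirichlet

variable {X : Type*} [MetricSpace X] [MeasurableSpace X] {μ : Measure X}

lemma jumpEnergy_congr (s : ℝ) {u v : X → ℝ} (h : u =ᵐ[μ] v) :
    jumpEnergy μ s u = jumpEnergy μ s v := by
  have h' : ∀ w : X → ℝ, jumpEnergy μ s w =
      ∫⁻ p, ENNReal.ofReal (jumpDensity s w w p) ∂(μ.prod μ) :=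
    fun w => by simp only [jumpEnergy, jumpDensity_self]
  rw [h', h']
  refine lintegral_congr_ae ?_
  filter_upwards [jumpDensity_congr s h h] with p hp
  rw [hp]

lemma jumpEnergy_le_of_abs_sub_le (s : ℝ) {u v : X → ℝ}
    (h : ∀ x y, |v x - v y| ≤ |u x - u y|) : jumpEnergy μ s v ≤ jumpEnergy μ s u := by
  refine lintegral_mono fun p => ENNReal.ofReal_le_ofReal ?_
  exact div_le_div_of_nonneg_right (sq_le_sq.2 (h _ _)) (by positivity)

lemma abs_unitClamp_sub_le (a b : ℝ) :
    |min (max a 0) 1 - min (max b 0) 1| ≤ |a - b| :=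
  calc |min (max a 0) 1 - min (max b 0) 1| ≤ |max a 0 - max b 0| := by
        simpa using abs_min_sub_min_le_max (max a 0) 1 (max b 0) 1
    _ ≤ |a - b| := by simpa using abs_max_sub_max_le_max a 0 b 0

variable [SecondCountableTopology X] [BorelSpace X]

lemma jumpEnergy_mul_lt_top {s M : ℝ} (u v : Lp ℝ 2 μ) {f g : X → ℝ}
    (hfM : ∀ x, |f x| ≤ M) (hgM : ∀ x, |g x| ≤ M)
    (hu : (u : X → ℝ) =ᵐ[μ] f) (hv : (v : X → ℝ) =ᵐ[μ] g)
    (hEu : jumpEnergy μ s u < ∞) (hEv : jumpEnergy μ s v < ∞) :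
    jumpEnergy μ s (f * g) < ∞ := by
  rw [jumpEnergy_lt_top_iff] at hEu hEv
  have h1 := (hEu.congr (jumpDensity_congr s hu hu)).const_mul (2 * M ^ 2)
  have h2 := (hEv.congr (jumpDensity_congr s hv hv)).const_mul (2 * M ^ 2)
  have h3 := (h1.add h2).hasFiniteIntegral
  refine lt_of_le_of_lt (lintegral_mono fun p => ?_)
    ((hasFiniteIntegral_iff_ofReal (ae_of_all _ fun p => ?_)).1 h3)
  · refine ENNReal.ofReal_le_ofReal ?_
    simp only [Pi.add_apply, jumpDensity_self, Pi.mul_apply]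
    rw [mul_div_assoc', mul_div_assoc', ← add_div]
    refine div_le_div_of_nonneg_right ?_ (by positivity)
    have hM : ∀ z : ℝ, |z| ≤ M → z ^ 2 ≤ M ^ 2 := fun z hz =>
      sq_le_sq.2 (hz.trans (le_abs_self M))
    -- Leibniz splitting; `(a + b) ^ 2 ≤ 2 a ^ 2 + 2 b ^ 2` then gives the factor `2 * M ^ 2`.
    have e : f p.1 * g p.1 - f p.2 * g p.2 =
        g p.1 * (f p.1 - f p.2) + f p.2 * (g p.1 - g p.2) := by ring
    rw [e]
    have h4 := mul_le_mul_of_nonneg_right (hM _ (hgM p.1)) (sq_nonneg (f p.1 - f p.2))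
    have h5 := mul_le_mul_of_nonneg_right (hM _ (hfM p.2)) (sq_nonneg (g p.1 - g p.2))
    nlinarith [sq_nonneg (g p.1 * (f p.1 - f p.2) - f p.2 * (g p.1 - g p.2))]
  · exact add_nonneg (mul_nonneg (by positivity) (jumpDensity_self_nonneg _ _ _))
      (mul_nonneg (by positivity) (jumpDensity_self_nonneg _ _ _))

lemma jumpForm_self_nonneg (s : ℝ) (u : jumpDomain μ s) : 0 ≤ jumpForm μ s u u :=
  integral_nonneg (jumpDensity_self_nonneg s _)

lemma jumpForm_self_le_of_jumpEnergy_le {s c : ℝ} (hc : 0 ≤ c) {u : jumpDomain μ s}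
    (h : jumpEnergy μ s (u : Lp ℝ 2 μ) ≤ ENNReal.ofReal c) : jumpForm μ s u u ≤ c := by
  rw [← ofReal_jumpForm_self] at h
  exact (ENNReal.ofReal_le_ofReal_iff hc).1 h

/-- Lower semicontinuity: Fatou along a subsequence converging almost everywhere. -/
lemma jumpEnergy_le_of_tendsto {s : ℝ} [SFinite μ] {u : ℕ → Lp ℝ 2 μ} {v : Lp ℝ 2 μ}
    (huv : Tendsto u atTop (𝓝 v)) {c : ℝ≥0∞} (hc : ∀ᶠ n in atTop, jumpEnergy μ s (u n) ≤ c) :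
    jumpEnergy μ s v ≤ c := by
  obtain ⟨ns, hns, hae⟩ := (tendstoInMeasure_of_tendsto_Lp huv).exists_seq_tendsto_ae
  have q1 := Measure.quasiMeasurePreserving_fst (μ := μ) (ν := μ)
  have q2 := Measure.quasiMeasurePreserving_snd (μ := μ) (ν := μ)
  have hE : ∀ w : Lp ℝ 2 μ, jumpEnergy μ s w =
      ∫⁻ p, ENNReal.ofReal (jumpDensity s w w p) ∂(μ.prod μ) := fun w => by
    simp only [jumpEnergy, jumpDensity_self]
  calc jumpEnergy μ s v
      ≤ ∫⁻ p, liminf (fun n => ENNReal.ofReal (jumpDensity s (u (ns n)) (u (ns n)) p)) atTop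
          ∂(μ.prod μ) := by
        rw [hE]
        refine lintegral_mono_ae ?_
        filter_upwards [q1.ae hae, q2.ae hae] with p h1 h2
        refine (Tendsto.liminf_eq ?_).ge
        exact ENNReal.tendsto_ofReal (((h1.sub h2).mul (h1.sub h2)).div_const _)
    _ ≤ liminf (fun n => ∫⁻ p, ENNReal.ofReal (jumpDensity s (u (ns n)) (u (ns n)) p)
          ∂(μ.prod μ)) atTop :=
        lintegral_liminf_le fun n => (jumpDensity_measurable s _ _).ennreal_ofReal
    _ ≤ c := by
        simp only [← hE]
        exact liminf_le_of_frequently_le (hns.tendsto_atTop.eventually hc).frequently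

theorem jumpForm_closed (s : ℝ) [SFinite μ] (u : ℕ → jumpDomain μ s)
    (hu : ∀ ε : ℝ, 0 < ε → ∃ N : ℕ, ∀ m, N ≤ m → ∀ n, N ≤ n →
      formNormSq (jumpForm μ s) (u m - u n) < ε) :
    ∃ v : jumpDomain μ s, Tendsto (fun n => formNormSq (jumpForm μ s) (u n - v)) atTop (𝓝 0) := by
  have hcau : CauchySeq fun n => (u n : Lp ℝ 2 μ) := by
    rw [Metric.cauchySeq_iff]
    intro ε hε
    obtain ⟨N, hN⟩ := hu (ε ^ 2) (by positivity)
    refine ⟨N, fun m hm n hn => ?_⟩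
    have h1 := hN m hm n hn
    have h2 := jumpForm_self_nonneg s (u m - u n)
    rw [formNormSq] at h1
    rw [dist_eq_norm]
    refine lt_of_pow_lt_pow_left₀ 2 hε.le ?_
    rw [← Submodule.coe_sub]
    linarith
  obtain ⟨v, hv⟩ := cauchySeq_tendsto_of_complete hcau
  -- Fix `m` and let `n → ∞` in the energy of `u m - u n`; semicontinuity transfers the Cauchy bound
  -- to `u m - v`.
  have hlim : ∀ ε : ℝ, 0 < ε → ∃ N : ℕ, ∀ m, N ≤ m →
      jumpEnergy μ s ((u m : Lp ℝ 2 μ) - v : Lp ℝ 2 μ) ≤ ENNReal.ofReal ε := by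
    intro ε hε
    obtain ⟨N, hN⟩ := hu ε hε
    refine ⟨N, fun m hm => ?_⟩
    refine jumpEnergy_le_of_tendsto (u := fun n => (u m : Lp ℝ 2 μ) - (u n : Lp ℝ 2 μ))
      (hv.const_sub _) ?_
    filter_upwards [eventually_ge_atTop N] with n hn
    rw [← Submodule.coe_sub, ← ofReal_jumpForm_self]
    refine ENNReal.ofReal_le_ofReal ?_
    have := hN m hm n hn
    rw [formNormSq] at this
    linarith [sq_nonneg ‖((u m - u n : jumpDomain μ s) : Lp ℝ 2 μ)‖]
  have hvF : v ∈ jumpDomain μ s := by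
    obtain ⟨N, hN⟩ := hlim 1 one_pos
    have h1 : (u N : Lp ℝ 2 μ) - v ∈ jumpDomain μ s :=
      lt_of_le_of_lt (hN N le_rfl) ENNReal.ofReal_lt_top
    have h2 := (jumpDomain μ s).sub_mem (u N).2 h1
    rwa [sub_sub_cancel] at h2
  refine ⟨⟨v, hvF⟩, ?_⟩
  have hE : Tendsto (fun n => jumpForm μ s (u n - ⟨v, hvF⟩) (u n - ⟨v, hvF⟩)) atTop (𝓝 0) := by
    rw [Metric.tendsto_atTop]
    intro ε hε
    obtain ⟨N, hN⟩ := hlim (ε / 2) (half_pos hε)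
    refine ⟨N, fun n hn => ?_⟩
    rw [Real.dist_eq, sub_zero, abs_of_nonneg (jumpForm_self_nonneg s _)]
    refine lt_of_le_of_lt (jumpForm_self_le_of_jumpEnergy_le (half_pos hε).le ?_) (half_lt_self hε)
    exact hN n hn
  have hL : Tendsto (fun n => ‖(u n : Lp ℝ 2 μ) - v‖ ^ 2) atTop (𝓝 0) := by
    simpa using (tendsto_iff_norm_sub_tendsto_zero.1 hv).pow 2
  simpa [formNormSq] using hE.add hL

theorem jumpForm_markov (s : ℝ) (u : jumpDomain μ s) : ∃ v : jumpDomain μ s,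
    ((v : Lp ℝ 2 μ) : X → ℝ) =ᵐ[μ] (fun x => min (max ((u : Lp ℝ 2 μ) x) 0) 1) ∧
      jumpForm μ s v v ≤ jumpForm μ s u u := by
  have hmem : MemLp (fun x => min (max ((u : Lp ℝ 2 μ) x) 0) 1) 2 μ := by
    refine (Lp.memLp (u : Lp ℝ 2 μ)).of_le ?_ (ae_of_all _ fun x => ?_)
    · have hm : Measurable fun z : ℝ => min (max z 0) 1 := by fun_prop
      exact (hm.comp (Lp.stronglyMeasurable (u : Lp ℝ 2 μ)).measurable).aestronglyMeasurable
    · simpa using abs_unitClamp_sub_le ((u : Lp ℝ 2 μ) x) 0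
  have hle : jumpEnergy μ s (hmem.toLp _) ≤ jumpEnergy μ s (u : Lp ℝ 2 μ) := by
    rw [jumpEnergy_congr s hmem.coeFn_toLp]
    exact jumpEnergy_le_of_abs_sub_le s fun x y => abs_unitClamp_sub_le _ _
  refine ⟨⟨hmem.toLp _, lt_of_le_of_lt hle u.2⟩, hmem.coeFn_toLp, ?_⟩
  refine jumpForm_self_le_of_jumpEnergy_le (jumpForm_self_nonneg s u) ?_
  rw [ofReal_jumpForm_self]
  exact hle

variable [CompactSpace X] [IsFiniteMeasure μ]

variable (μ) in
/-- The algebra of continuous functions of finite energy. -/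
noncomputable def finiteEnergyAlgebra (s : ℝ) : Subalgebra ℝ C(X, ℝ) where
  carrier := {g | ContinuousMap.toLp 2 μ ℝ g ∈ jumpDomain μ s}
  mul_mem' := by
    intro f g hf hg
    have hb : ∀ h : C(X, ℝ), ‖h‖ ≤ max ‖f‖ ‖g‖ → ∀ x, |h x| ≤ max ‖f‖ ‖g‖ :=
      fun h hh x => (h.norm_coe_le_norm x).trans hh
    have := jumpEnergy_mul_lt_top _ _
      (hb f (le_max_left _ _)) (hb g (le_max_right _ _)) (ContinuousMap.coeFn_toLp μ (𝕜 := ℝ) f)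
      (ContinuousMap.coeFn_toLp μ (𝕜 := ℝ) g) hf hg
    rw [mem_ofPred_eq]
    change jumpEnergy μ s _ < ∞
    rwa [jumpEnergy_congr s (ContinuousMap.coeFn_toLp μ (f * g))]
  add_mem' := by
    intro f g hf hg
    rw [mem_ofPred_eq, map_add]
    exact (jumpDomain μ s).add_mem hf hg
  algebraMap_mem' := by
    intro c
    change jumpEnergy μ s _ < ∞
    rw [jumpEnergy_congr s (ContinuousMap.coeFn_toLp μ _)]
    simp [jumpEnergy]

lemma mem_finiteEnergyAlgebra {s : ℝ} {g : C(X, ℝ)} :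
    g ∈ finiteEnergyAlgebra μ s ↔ jumpEnergy μ s g < ∞ := by
  rw [← jumpEnergy_congr s (ContinuousMap.coeFn_toLp μ (𝕜 := ℝ) (p := 2) g)]
  rfl

/-- Stone–Weierstrass, followed by density of the continuous functions in `L²`. -/
theorem dense_jumpDomain {s : ℝ} (hsep : (finiteEnergyAlgebra μ s).SeparatesPoints) :
    Dense (jumpDomain μ s : Set (Lp ℝ 2 μ)) := by
  have htop := ContinuousMap.subalgebra_topologicalClosure_eq_top_of_separatesPoints _ hsep
  have hd : Dense (finiteEnergyAlgebra μ s : Set C(X, ℝ)) := by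
    rw [dense_iff_closure_eq, ← Subalgebra.topologicalClosure_coe, htop]
    rfl
  have := (ContinuousMap.toLp_denseRange ℝ μ (p := 2) ℝ (by norm_num)).dense_image
    (ContinuousMap.toLp 2 μ ℝ).continuous hd
  refine this.mono ?_
  rintro _ ⟨g, hg, rfl⟩
  exact hg

/-- If finite energy functions are continuous and the continuous ones separate points, then the
jump form is a regular Dirichlet form. -/
theorem isRegularDirichletForm_jumpForm {s : ℝ} [μ.IsOpenPosMeasure]
    (hcont : ∀ u : Lp ℝ 2 μ, jumpEnergy μ s u < ∞ → ∃ g : X → ℝ, Continuous g ∧ (u : X → ℝ) =ᵐ[μ] g)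
    (hsep : (finiteEnergyAlgebra μ s).SeparatesPoints) :
    IsRegularDirichletForm μ (jumpDomain μ s) (jumpForm μ s) where
  dense_domain := dense_jumpDomain hsep
  symm u v := integral_congr_ae (ae_of_all _ fun p => jumpDensity_comm s _ _ p)
  nonneg := jumpForm_self_nonneg s
  closed := jumpForm_closed s
  markov := jumpForm_markov s
  finite_on_compacts := inferInstance
  full_support := inferInstance
  dense_in_domain u ε hε := by
    obtain ⟨g, hg, hug⟩ := hcont u u.2
    -- Having a continuous version, `u` is its own approximant.
    refine ⟨u, ⟨g, hg, HasCompactSupport.of_compactSpace g, hug⟩, ?_⟩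
    simpa [formNormSq] using hε
  dense_in_continuous f hf _ ε hε := by
    obtain ⟨g, hg⟩ :=
      ContinuousMap.exists_mem_subalgebra_near_continuous_of_separatesPoints _ hsep f hf ε hε
    refine ⟨g, g.1.continuous, HasCompactSupport.of_compactSpace _,
      ⟨⟨_, g.2⟩, ContinuousMap.coeFn_toLp μ g.1⟩, fun x => ?_⟩
    rw [abs_sub_comm]
    exact hg x

end JumpDirichlet

/-! ### Application to the gasket -/

lemma le_measureReal_closedBall (x : sierpinskiGasket) {r : ℝ} (h0 : 0 < r) (h1 : r ≤ 1) :
    1 / 9 * r ^ gasketDim ≤ gasketMeasure.real (Metric.closedBall x r) := by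
  -- With `r / 2 ≤ 2⁻ⁿ < r`, the ball has mass at least `3 ^ (-(n + 1))`, while `r ^ α ≤ 3 * 3⁻ⁿ`;
  -- hence the constant `1/9`.
  obtain ⟨n, hn, hn'⟩ := exists_half_pow_bounds (half_pos h0) (by linarith : r / 2 ≤ 1)
  have hb : 3⁻¹ ^ (n + 1) ≤ gasketMeasure (Metric.closedBall x r) :=
    (le_gasketMeasure_closedBall x (n + 1)).trans
      (measure_mono (Metric.closedBall_subset_closedBall (by rw [pow_succ]; linarith)))
  have h2 : (1 / 3 : ℝ) ^ (n + 1) ≤ gasketMeasure.real (Metric.closedBall x r) := by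
    have := ENNReal.toReal_mono (measure_ne_top _ _) hb
    simpa [measureReal_def] using this
  refine le_trans ?_ h2
  have h3 : r ^ gasketDim ≤ (2 * (1 / 2) ^ n) ^ gasketDim :=
    Real.rpow_le_rpow h0.le (by linarith) gasketDim_pos.le
  rw [Real.mul_rpow (by norm_num) (by positivity), two_rpow_gasketDim,
    half_pow_rpow_gasketDim] at h3
  rw [pow_succ]
  linarith

theorem mainTheorem2 (β : ℝ) (hβ₁ : Real.log 3 / Real.log 2 < β)
    (hβ₂ : β < Real.log 5 / Real.log 2) :
    IsRegularDirichletForm gasketMeasure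
      (jumpDomain gasketMeasure (gasketDim + β)) (jumpForm gasketMeasure (gasketDim + β)) := by
  have hβ : gasketDim < β := hβ₁
  have hα := gasketDim_pos
  have := gasketMeasure_isOpenPosMeasure
  -- Here `2 ^ α = 3` and `2 ^ β < 5`.
  have h15 : (2 : ℝ) ^ (gasketDim + β) < 15 := by
    have h5 : (2 : ℝ) ^ β < 5 :=
      lt_of_lt_of_eq (Real.rpow_lt_rpow_of_exponent_lt (by norm_num) hβ₂)
        (Real.rpow_logb (by norm_num) (by norm_num) (by norm_num))
    rw [Real.rpow_add (by norm_num), two_rpow_gasketDim]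
    linarith
  refine isRegularDirichletForm_jumpForm (fun u hu => ?_) fun x y hxy => ?_
  · exact exists_continuous_of_jumpEnergy_lt_top (by norm_num) hα.le (by linarith)
      (fun x r => le_measureReal_closedBall x) u hu
  · by_contra hcon
    refine hxy (harmonicFun_separates fun a => ?_)
    by_contra ha
    exact hcon ⟨_, ⟨⟨harmonicFun a, harmonicFun_continuous a⟩,
      mem_finiteEnergyAlgebra.2 (jumpEnergy_harmonicFun_lt_top (by linarith) h15 a), rfl⟩, ha⟩
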